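/- Let $F$ be a non-archimedean local field with ring of integers $\mathcal O$ and normalized absolute value $|\cdot|$, let $K=\mathrm{GL}_2(\mathcal O)$, and let $\psi$ be a non-trivial continuous unitary character of $F$. Fix Haar measures $dx$ on $F$, $d^\times x$ on $F^\times$ and $dk$ on $K$. Let $\pi_1,\pi_2$ be irreducible admissible generic representations of $\mathrm{GL}_2(F)$ with central characters $\omega_{\pi_1},\omega_{\pi_2}$ satisfying $\omega_{\pi_1}\omega_{\pi_2}=1$, let $\mathcal W(\pi_i,\psi)$ be their $\psi$-Whittaker models, and let $\mu$ be a quasi-character of $F^\times$. For a Whittaker function $W$, a quasi-character $\chi$ and $s\in\mathbb C$ put $$Z(W,\chi|\cdot|^{s})=\int_{F^\times}W\begin{pmatrix}a&\\&1\end{pmatrix}\chi(a)|a|^{s-\frac12}\,d^\times a ,$$ and for $W_i\in\mathcal W(\pi_i,\psi)$ and a Schwartz–Bruhat (locally constant, compactly supported) function $f$ on $\mathsf M_2(F)\times \mathsf M_2(F)$ put $$\begin{aligned}\mathcal Z(W_1,W_2,f;\mu,|\cdot|^{s_1},|\cdot|^{s_2})=&\int_{u,v\in F}\int_{\epsilon\in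 F^\times}\int_{K^2} f\Big(k_1^{-1}\begin{pmatrix}\epsilon^{-1}&\epsilon^{-1}v\\0&0\end{pmatrix}k_2,\ k_1^{-1}\begin{pmatrix}0&-u\epsilon\\0&\epsilon\end{pmatrix}k_2\Big)\,\omega_{\pi_2}(\epsilon)\mu(\epsilon)^{-2}|\epsilon|^{2s_2-2}\\ &\times\Big(\int_{F^\times}W_1\big(\begin{pmatrix}\alpha&\\&1\end{pmatrix}k_1\big)\psi(u\alpha)\mu(\alpha)|\alpha|^{s_1-\frac12}d^\times\alpha\Big)\Big(\int_{F^\times}W_2\big(\begin{pmatrix}\beta&\\&1\end{pmatrix}k_2\big)\psi(v\beta)\mu^{-1}(\beta)|\beta|^{s_2-\frac12}d^\times\beta\Big)\,du\,dv\,d^\times\epsilon\,dk_1\,dk_2 .\end{aligned}$$ (a) Let $W_1\in\mathcal W(\pi_1,\psi)$ and $W_2\in\mathcal W(\pi_2,\psi)$ be given. The integrals $Z(W_1,\mu|\cdot|^{s})$ and $Z(W_2,\mu^{-1}|\cdot|^{s})$ converge absolutely for $\Re s$ sufficiently large. For every neighbourhood $U$ of the point $\Big(\begin{pmatrix}1&0\\0&0\end{pmatrix},\begin{pmatrix}0&0\\0&1\end{pmatrix}\Big)$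 there is a Schwartz–Bruhat function $f$ with support in $U$, independent of $s_1,s_2$, such that for all $s_1,s_2\in\mathbb C$ for which $Z(W_1,\mu|\cdot|^{s_1})$ and $Z(W_2,\mu^{-1}|\cdot|^{s_2})$ converge absolutely, $\mathcal Z(W_1,W_2,f;\mu,|\cdot|^{s_1},|\cdot|^{s_2})$ converges absolutely (as a multiple integral over $u,v,\epsilon,k_1,k_2,\alpha,\beta$) and $$\mathcal Z(W_1,W_2,f;\mu,|\cdot|^{s_1},|\cdot|^{s_2})=Z(W_1,\mu|\cdot|^{s_1})\,Z(W_2,\mu^{-1}|\cdot|^{s_2}).$$ (b) There are $W_1\in\mathcal W(\pi_1,\psi)$, $W_2\in\mathcal W(\pi_2,\psi)$ and a Schwartz–Bruhat function $f$ such that for all $s_1,s_2\in\mathbb C$ the integral $\mathcal Z(W_1,W_2,f;\mu,|\cdot|^{s_1},|\cdot|^{s_2})$ converges absolutely and equals $1$. -/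

import Mathlib

open MeasureTheory ValuativeRel Topology

noncomputable section

namespace GLTwoZeta

section Group

variable {F : Type*} [Field F]

/-- The matrix `diag(a, 1)`. -/
def diagOne (a : Fˣ) : GL (Fin 2) F :=
  Matrix.GeneralLinearGroup.mkOfDetNeZero !![(a : F), 0; 0, 1] (by simp)

end Group

section Representation

variable {F : Type*} [Field F] [TopologicalSpace F]
variable {V : Type*} [AddCommGroup V] [Module ℂ V]

/-- The space of vectors fixed by an open subgroup. -/
def fixedVectors (π : Representation ℂ (GL (Fin 2) F) V) (U : OpenSubgroup (GL (Fin 2) F)) :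
    Submodule ℂ V where
  carrier := {v | ∀ g ∈ U, π g v = v}
  add_mem' := fun {a b} ha hb g hg => by rw [map_add, ha g hg, hb g hg]
  zero_mem' := fun g _ => map_zero (π g)
  smul_mem' := fun c x hx g hg => by rw [map_smul, hx g hg]

/-- An irreducible admissible (smooth) representation of `GL₂(F)`. -/
structure IsIrredAdmissible (π : Representation ℂ (GL (Fin 2) F) V) : Prop where
  irreducible : π.IsIrreducible
  smooth : ∀ v : V, ∃ U : OpenSubgroup (GL (Fin 2) F), v ∈ fixedVectors π U
  admissible : ∀ U : OpenSubgroup (GL (Fin 2) F), FiniteDimensional ℂ (fixedVectors π U)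

/-- `ω` is the central character of `π`. -/
def IsCentralCharacter (π : Representation ℂ (GL (Fin 2) F) V) (ω : Fˣ →* ℂˣ) : Prop :=
  ∀ (z : Fˣ) (v : V), π (Matrix.GeneralLinearGroup.scalar (Fin 2) z) v = ((ω z : ℂˣ) : ℂ) • v

/-- A `ψ`-Whittaker functional on `π`: `l (π (n x) v) = ψ x * l v`, where `n x` is the upper
triangular unipotent matrix with upper right entry `x`. -/
def IsWhittakerFunctional (π : Representation ℂ (GL (Fin 2) F) V) (ψ : AddChar F Circle)
    (l : V →ₗ[ℂ] ℂ) : Prop :=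
  ∀ (x : F) (v : V), l (π (Matrix.GeneralLinearGroup.upperRightHom x) v) = (ψ x : ℂ) * l v

/-- `π` is generic: it has a non-zero `ψ`-Whittaker functional. -/
def IsGeneric (π : Representation ℂ (GL (Fin 2) F) V) (ψ : AddChar F Circle) : Prop :=
  ∃ l : V →ₗ[ℂ] ℂ, l ≠ 0 ∧ IsWhittakerFunctional π ψ l

/-- The Whittaker model `𝒲(π, ψ)`: the functions `g ↦ l (π g v)`, with `l` a Whittaker functional
and `v` a vector of `π`. -/
def whittakerModel (π : Representation ℂ (GL (Fin 2) F) V) (ψ : AddChar F Circle) :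
    Set (GL (Fin 2) F → ℂ) :=
  {W | ∃ (l : V →ₗ[ℂ] ℂ) (v : V), IsWhittakerFunctional π ψ l ∧ W = fun g => l (π g v)}

end Representation

section LocalField

variable {F : Type*} [Field F] [ValuativeRel F] [TopologicalSpace F]
  [IsNonarchimedeanLocalField F]

/-- The normalized absolute value on `F`: a uniformizer has absolute value `1 / q`, with `q` the
number of elements of the residue field. -/
def normAbs (x : F) : ℝ :=
  (WithZeroMulInt.toNNReal (e := (Nat.card 𝓀[F] : NNReal))
    (by exact_mod_cast Nat.card_pos.ne')
    (IsNonarchimedeanLocalField.valueGroupWithZeroIsoInt F (valuation F x)) : ℝ)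

/-- `|a|^s` as a complex number. -/
def absPow (a : Fˣ) (s : ℂ) : ℂ := (normAbs (a : F) : ℂ) ^ s

variable (F) in
/-- The maximal compact subgroup `K = GL₂(𝒪)`. -/
abbrev maxCompact : Type _ := GL (Fin 2) 𝒪[F]

instance : MeasurableSpace (maxCompact F) := borel _

instance : BorelSpace (maxCompact F) := ⟨rfl⟩

/-- The inclusion of `K` in `GL₂(F)`. -/
def inclK : maxCompact F →* GL (Fin 2) F :=
  Matrix.GeneralLinearGroup.map (algebraMap 𝒪[F] F)

/-- Schwartz–Bruhat functions on `M₂(F) × M₂(F)`. -/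
def IsSchwartzBruhat (f : Matrix (Fin 2) (Fin 2) F × Matrix (Fin 2) (Fin 2) F → ℂ) : Prop :=
  IsLocallyConstant f ∧ HasCompactSupport f

variable (F) in
/-- The base point `(diag(1, 0), diag(0, 1))`. -/
def basePoint : Matrix (Fin 2) (Fin 2) F × Matrix (Fin 2) (Fin 2) F :=
  (!![1, 0; 0, 0], !![0, 0; 0, 1])

/-- The integrand `W(diag(a, 1)) χ(a) |a|^(s - 1/2)` of the zeta integral `Z(W, χ|·|^s)`. -/
def zetaIntegrand (W : GL (Fin 2) F → ℂ) (χ : Fˣ →* ℂˣ) (s : ℂ) (a : Fˣ) : ℂ :=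
  W (diagOne a) * ((χ a : ℂˣ) : ℂ) * absPow a (s - 1 / 2)

/-- The integrand `W(diag(a, 1) k) ψ(u a) χ(a) |a|^(s - 1/2)` of the inner integrals. -/
def innerIntegrand (ψ : AddChar F Circle) (W : GL (Fin 2) F → ℂ) (χ : Fˣ →* ℂˣ) (s : ℂ)
    (u : F) (k : maxCompact F) (a : Fˣ) : ℂ :=
  W (diagOne a * inclK k) * (ψ (u * a) : ℂ) * ((χ a : ℂˣ) : ℂ) * absPow a (s - 1 / 2)

/-- The pair of matrices at which the Schwartz function is evaluated. -/
def orbitPoint (u v : F) (e : Fˣ) (k₁ k₂ : maxCompact F) :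
    Matrix (Fin 2) (Fin 2) F × Matrix (Fin 2) (Fin 2) F :=
  (((inclK k₁)⁻¹ : GL (Fin 2) F).val * !![(e : F)⁻¹, (e : F)⁻¹ * v; 0, 0] * (inclK k₂).val,
   ((inclK k₁)⁻¹ : GL (Fin 2) F).val * !![0, -(u * e); 0, (e : F)] * (inclK k₂).val)

/-- The outer factor `f(⋯) ω(ε) μ(ε)⁻² |ε|^(2 s₂ - 2)`. -/
def outerFactor (f : Matrix (Fin 2) (Fin 2) F × Matrix (Fin 2) (Fin 2) F → ℂ)
    (ω μ : Fˣ →* ℂˣ) (s₂ : ℂ) (u v : F) (e : Fˣ) (k₁ k₂ : maxCompact F) : ℂ :=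
  f (orbitPoint u v e k₁ k₂) * ((ω e : ℂˣ) : ℂ) * (((μ e)⁻¹ ^ 2 : ℂˣ) : ℂ) * absPow e (2 * s₂ - 2)

variable [MeasurableSpace F]

/-- The zeta integral `Z(W, χ|·|^s) = ∫ W(diag(a, 1)) χ(a) |a|^(s - 1/2) d^×a`. -/
def zeta (dm : Measure Fˣ) (W : GL (Fin 2) F → ℂ) (χ : Fˣ →* ℂˣ) (s : ℂ) : ℂ :=
  ∫ a, zetaIntegrand W χ s a ∂dm

/-- Absolute convergence of `Z(W, χ|·|^s)`. -/
def ZetaConverges (dm : Measure Fˣ) (W : GL (Fin 2) F → ℂ) (χ : Fˣ →* ℂˣ) (s : ℂ) : Prop :=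
  Integrable (zetaIntegrand W χ s) dm

/-- The zeta integral in two complex variables, an integral over
`(u, v, ε, k₁, k₂) ∈ F × F × Fˣ × K × K`. Here `ω` is the central character of the representation
to which `W₂` belongs. -/
def zetaTwo (dx : Measure F) (dm : Measure Fˣ) (dk : Measure (maxCompact F))
    (ψ : AddChar F Circle) (ω : Fˣ →* ℂˣ) (W₁ W₂ : GL (Fin 2) F → ℂ)
    (f : Matrix (Fin 2) (Fin 2) F × Matrix (Fin 2) (Fin 2) F → ℂ)
    (μ : Fˣ →* ℂˣ) (s₁ s₂ : ℂ) : ℂ :=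
  ∫ p : F × F × Fˣ × maxCompact F × maxCompact F,
    (match p with
      | (u, v, e, k₁, k₂) =>
        outerFactor f ω μ s₂ u v e k₁ k₂ *
          (∫ a, innerIntegrand ψ W₁ μ s₁ u k₁ a ∂dm) *
          (∫ b, innerIntegrand ψ W₂ μ⁻¹ s₂ v k₂ b ∂dm))
    ∂(dx.prod (dx.prod (dm.prod (dk.prod dk))))

/-- Absolute convergence of the zeta integral in two complex variables, as a multiple integral over
all the variables `(u, v, ε, k₁, k₂, α, β)`. -/
def ZetaTwoConverges (dx : Measure F) (dm : Measure Fˣ) (dk : Measure (maxCompact F))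
    (ψ : AddChar F Circle) (ω : Fˣ →* ℂˣ) (W₁ W₂ : GL (Fin 2) F → ℂ)
    (f : Matrix (Fin 2) (Fin 2) F × Matrix (Fin 2) (Fin 2) F → ℂ)
    (μ : Fˣ →* ℂˣ) (s₁ s₂ : ℂ) : Prop :=
  Integrable
    (fun p : (F × F × Fˣ × maxCompact F × maxCompact F) × Fˣ × Fˣ =>
      match p with
      | ((u, v, e, k₁, k₂), a, b) =>
        outerFactor f ω μ s₂ u v e k₁ k₂ *
          innerIntegrand ψ W₁ μ s₁ u k₁ a * innerIntegrand ψ W₂ μ⁻¹ s₂ v k₂ b)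
    ((dx.prod (dx.prod (dm.prod (dk.prod dk)))).prod (dm.prod dm))

end LocalField

end GLTwoZeta

end

/-!
Take for `f` the normalized indicator function of a small neighbourhood of the base point. With
`g₁ = n(u) k₁` and `g₂ = n(v) k₂` the point at which `f` is evaluated is
`(ε⁻¹ g₁⁻¹ E₁₁ g₂, ε g₁⁻¹ E₂₂ g₂)`. It is near the base point only if `g₁` and `g₂` are nearly
diagonal, with diagonal entries `(a₁, d₁)` and `(a₂, d₂)` of absolute value one satisfying
`a₂ ≈ ε a₁` and `d₁ ≈ ε d₂`. By `ψ`-equivariance the inner integrands are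
`W(diag(α, 1) gᵢ) χ(α) |α|^(s - 1/2)`; by smoothness and the central characters they are multiples
of translates of the integrands of the zeta integrals, and the multiples cancel against
`ω₂(ε) μ(ε)⁻²`.

The zeta integrals converge for `Re s` large: `W(diag(a, 1))` vanishes for `|a|` large, and for
`|a|` small a Hecke operator of the uniformizer `ϖ` shifts `a` to `ϖ a` while it acts on the
finite-dimensional space of vectors fixed by a congruence subgroup, so that `W(diag(a, 1))` grows
at most geometrically as `a` tends to zero.

For the second part, an average over unipotent translates weighted by `ψ⁻¹` cuts `W(diag(a, 1))`
down to a small compact neighbourhood of `1`, on which `W`, `μ` and `|·|` are constant.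
-/

noncomputable section

namespace GLTwoZeta

open Matrix.GeneralLinearGroup (upperRightHom)
open scoped NNReal

section NormAbs

variable {F : Type*} [Field F] [ValuativeRel F] [TopologicalSpace F]
  [IsNonarchimedeanLocalField F]

variable (F) in
lemma one_lt_card_residueField : (1 : ℝ≥0) < Nat.card 𝓀[F] := by
  exact_mod_cast Finite.one_lt_card

lemma normAbs_def (x : F) : normAbs x =
    (WithZeroMulInt.toNNReal (zero_lt_one.trans (one_lt_card_residueField F)).ne'
      (IsNonarchimedeanLocalField.valueGroupWithZeroIsoInt F (valuation F x)) : ℝ) := rfl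

lemma normAbs_le_iff {x y : F} : normAbs x ≤ normAbs y ↔ valuation F x ≤ valuation F y := by
  rw [normAbs_def, normAbs_def, NNReal.coe_le_coe,
    (WithZeroMulInt.toNNReal_strictMono (one_lt_card_residueField F)).le_iff_le]
  exact OrderIsoClass.map_le_map_iff _

@[simp] lemma normAbs_zero : normAbs (0 : F) = 0 := by simp [normAbs_def]

@[simp] lemma normAbs_one : normAbs (1 : F) = 1 := by simp [normAbs_def]

@[simp] lemma normAbs_mul (x y : F) : normAbs (x * y) = normAbs x * normAbs y := by
  simp [normAbs_def]

@[simp] lemma normAbs_neg (x : F) : normAbs (-x) = normAbs x := by simp [normAbs_def]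

@[simp] lemma normAbs_inv (x : F) : normAbs x⁻¹ = (normAbs x)⁻¹ := by simp [normAbs_def]

@[simp] lemma normAbs_pow (x : F) (n : ℕ) : normAbs (x ^ n) = normAbs x ^ n := by
  simp [normAbs_def]

lemma normAbs_nonneg (x : F) : 0 ≤ normAbs x := NNReal.coe_nonneg _

lemma normAbs_pos {x : F} (hx : x ≠ 0) : 0 < normAbs x := by
  rw [normAbs_def, NNReal.coe_pos]
  exact WithZeroMulInt.toNNReal_pos _ (by simpa using hx)

lemma normAbs_unit_pos (x : Fˣ) : 0 < normAbs (x : F) := normAbs_pos x.ne_zero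

lemma normAbs_le_one_iff {x : F} : normAbs x ≤ 1 ↔ x ∈ 𝒪[F] := by
  rw [← normAbs_one (F := F), normAbs_le_iff, map_one, Valuation.mem_integer_iff]

lemma normAbs_integer (x : 𝒪[F]) : normAbs (x : F) ≤ 1 := normAbs_le_one_iff.2 x.2

lemma normAbs_add_le_max (x y : F) : normAbs (x + y) ≤ max (normAbs x) (normAbs y) := by
  rcases (valuation F).map_add' x y with h | h
  · exact le_max_of_le_left (normAbs_le_iff.2 h)
  · exact le_max_of_le_right (normAbs_le_iff.2 h)

lemma normAbs_add_le {x y : F} {r : ℝ} (hx : normAbs x ≤ r) (hy : normAbs y ≤ r) :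
    normAbs (x + y) ≤ r :=
  (normAbs_add_le_max x y).trans (max_le hx hy)

lemma normAbs_sub_le {x y : F} {r : ℝ} (hx : normAbs x ≤ r) (hy : normAbs y ≤ r) :
    normAbs (x - y) ≤ r := by
  rw [sub_eq_add_neg]
  exact normAbs_add_le hx ((normAbs_neg y).trans_le hy)

lemma normAbs_mul_le {x y : F} {r s : ℝ} (hx : normAbs x ≤ r) (hy : normAbs y ≤ s) :
    normAbs (x * y) ≤ r * s := by
  rw [normAbs_mul]
  exact mul_le_mul hx hy (normAbs_nonneg _) ((normAbs_nonneg _).trans hx)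

lemma normAbs_eq_of_sub_lt {x y : F} (h : normAbs (y - x) < normAbs x) :
    normAbs y = normAbs x := by
  apply le_antisymm
  · simpa using normAbs_add_le (x := y - x) (y := x) h.le le_rfl
  · by_contra! hlt
    have hle := normAbs_add_le_max y (-(y - x))
    rw [show y + -(y - x) = x by ring, normAbs_neg] at hle
    exact (hle.trans_lt (max_lt hlt h)).false

lemma normAbs_eq_one_of_sub_one_le {x : F} {r : ℝ≥0} (hr : r < 1) (h : normAbs (x - 1) ≤ r) :
    normAbs x = 1 := by
  rw [← normAbs_one (F := F)]
  exact normAbs_eq_of_sub_lt (h.trans_lt (by simpa using hr))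

lemma normAbs_mul_inv_sub_one {x y : F} (hy : normAbs y = 1) :
    normAbs (x * y⁻¹ - 1) = normAbs (x - y) := by
  have hy0 : y ≠ 0 := by rintro rfl; simp at hy
  rw [show x * y⁻¹ - 1 = (x - y) * y⁻¹ by field_simp, normAbs_mul, normAbs_inv, hy, inv_one,
    mul_one]

lemma normAbs_div_sub_one_le {x y : F} {r : ℝ≥0} (hr : r < 1) (hx : normAbs (x - 1) ≤ r)
    (hy : normAbs (y - 1) ≤ r) : normAbs (x / y - 1) ≤ r := by
  rw [div_eq_mul_inv, normAbs_mul_inv_sub_one (normAbs_eq_one_of_sub_one_le hr hy),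
    ← sub_sub_sub_cancel_right _ _ 1]
  exact normAbs_sub_le hx hy

lemma normAbs_mul_sub_one_le {x y : F} {r : ℝ} (hx : normAbs x ≤ 1) (hx1 : normAbs (x - 1) ≤ r)
    (hy1 : normAbs (y - 1) ≤ r) : normAbs (x * y - 1) ≤ r := by
  rw [show x * y - 1 = x * (y - 1) + (x - 1) by ring]
  exact normAbs_add_le (by simpa using normAbs_mul_le hx hy1) hx1

lemma normAbs_pow_sub_one_le {x : F} {r : ℝ} (hr : 0 ≤ r) (hx : normAbs x ≤ 1)
    (hx1 : normAbs (x - 1) ≤ r) (n : ℕ) : normAbs (x ^ n - 1) ≤ r := by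
  induction n with
  | zero => simpa using hr
  | succ n ih =>
    rw [pow_succ']
    exact normAbs_mul_sub_one_le hx hx1 ih

lemma normAbs_le_of_mul_le_of_mul_sub_one_le {x y z : F} {r : ℝ≥0} (hr : r < 1)
    (hxy : normAbs (x * y - 1) ≤ r) (hzy : normAbs (z * y) ≤ r) :
    normAbs z ≤ r * normAbs x := by
  have hxy1 : normAbs x * normAbs y = 1 := by
    rw [← normAbs_mul, normAbs_eq_one_of_sub_one_le hr hxy]
  calc normAbs z = normAbs (z * y) * normAbs x := by
        rw [normAbs_mul, mul_assoc, mul_comm (normAbs y), hxy1, mul_one]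
    _ ≤ r * normAbs x := by gcongr; exact normAbs_nonneg x

variable (F) in
lemma exists_normAbs_lt_one : ∃ ϖ : Fˣ, normAbs (ϖ : F) < 1 := by
  obtain ⟨x, hx0, hx1⟩ := Valuation.IsNontrivial.exists_lt_one (v := valuation F)
  refine ⟨Units.mk0 x hx0, not_le.1 fun h ↦ ?_⟩
  rw [← normAbs_one (F := F), normAbs_le_iff, map_one] at h
  exact h.not_gt hx1

end NormAbs

section Topology

variable {F : Type*} [Field F] [ValuativeRel F] [TopologicalSpace F]
  [IsNonarchimedeanLocalField F]

variable (F) in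
lemma hasBasis_nhds_zero_normAbs :
    (𝓝 (0 : F)).HasBasis (fun r : ℝ ↦ 0 < r) fun r ↦ {x | normAbs x ≤ r} := by
  obtain ⟨ϖ, hϖ⟩ := exists_normAbs_lt_one F
  refine (IsValuativeTopology.hasBasis_nhds_zero' F).to_hasBasis ?_ ?_
  · intro γ hγ
    obtain ⟨y, rfl⟩ := ValuativeRel.valuation_surjective γ
    have hy : y ≠ 0 := by rintro rfl; simp at hγ
    refine ⟨normAbs (ϖ * y : F), normAbs_pos (mul_ne_zero ϖ.ne_zero hy), fun x hx ↦ ?_⟩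
    refine lt_of_not_ge (α := ValueGroupWithZero F) fun h ↦ ?_
    have hle : normAbs y ≤ normAbs (ϖ : F) * normAbs y := by
      simpa using (normAbs_le_iff.2 h).trans hx
    exact (mul_lt_of_lt_one_left (normAbs_pos hy) hϖ).not_ge hle
  · intro r hr
    obtain ⟨n, hn⟩ := exists_pow_lt_of_lt_one hr hϖ
    refine ⟨valuation F ((ϖ : F) ^ n), by simp, fun x hx ↦ ?_⟩
    exact (normAbs_le_iff.2 (le_of_lt hx)).trans ((normAbs_pow _ n).trans_le hn.le)

variable (F) in
/-- The closed ball of radius `r` about zero, an additive subgroup of `F`. -/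
def ball (r : ℝ≥0) : AddSubgroup F where
  carrier := {x | normAbs x ≤ r}
  add_mem' := normAbs_add_le
  zero_mem' := by simp
  neg_mem' := by simp

lemma mem_ball {r : ℝ≥0} {x : F} : x ∈ ball F r ↔ normAbs x ≤ r := Iff.rfl

lemma isOpen_ball {r : ℝ≥0} (hr : 0 < r) : IsOpen (ball F r : Set F) :=
  AddSubgroup.isOpen_of_mem_nhds _ (g := 0)
    ((hasBasis_nhds_zero_normAbs F).mem_of_mem (NNReal.coe_pos.2 hr))

variable (F) in
lemma exists_le_normAbs (R : ℝ) : ∃ y : F, R ≤ normAbs y := by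
  obtain ⟨ϖ, hϖ⟩ := exists_normAbs_lt_one F
  obtain ⟨m, hm⟩ := pow_unbounded_of_one_lt R ((one_lt_inv₀ (normAbs_unit_pos ϖ)).2 hϖ)
  exact ⟨(ϖ : F)⁻¹ ^ m, by simpa using hm.le⟩

lemma isCompact_ball {r : ℝ≥0} (hr : 0 < r) : IsCompact (ball F r : Set F) := by
  obtain ⟨y, hy⟩ := exists_le_normAbs F r
  exact (IsNonarchimedeanLocalField.isCompact_closedBall F (valuation F y)).of_isClosed_subset
    (AddSubgroup.isClosed_of_isOpen _ (isOpen_ball hr)) fun x hx ↦ normAbs_le_iff.1 (le_trans hx hy)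

instance : SecondCountableTopology F := by
  let := IsTopologicalAddGroup.rightUniformSpace F
  have := isUniformAddGroup_of_addCommGroup (G := F)
  let : (Valued.v (R := F)).RankOne :=
  { hom' := IsRankLeOne.nonempty.some.emb (R := F).comp MonoidWithZeroHom.ValueGroup₀.embedding
    strictMono' := IsRankLeOne.nonempty.some.strictMono.comp
        MonoidWithZeroHom.ValueGroup₀.embedding_strictMono }
  open scoped Valued in
  have : ProperSpace F := .of_nontriviallyNormedField_of_weaklyLocallyCompactSpace F
  infer_instance

instance : T2Space F := by
  let := IsTopologicalAddGroup.rightUniformSpace F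
  have := isUniformAddGroup_of_addCommGroup (G := F)
  infer_instance

instance : SecondCountableTopology Fˣ :=
  Units.isEmbedding_val₀.secondCountableTopology

instance : SecondCountableTopology (maxCompact F) := by
  have : SecondCountableTopology 𝒪[F] := IsEmbedding.subtypeVal.secondCountableTopology
  have : SecondCountableTopology (Matrix (Fin 2) (Fin 2) 𝒪[F]) :=
    inferInstanceAs (SecondCountableTopology (Fin 2 → Fin 2 → 𝒪[F]))
  have : SecondCountableTopology (Matrix (Fin 2) (Fin 2) 𝒪[F])ᵐᵒᵖ :=
    MulOpposite.opHomeomorph.symm.isEmbedding.secondCountableTopology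
  exact Units.isEmbedding_embedProduct.secondCountableTopology

instance : CompactSpace (maxCompact F) := by
  have : T1Space (Matrix (Fin 2) (Fin 2) 𝒪[F]) := inferInstanceAs (T1Space (Fin 2 → Fin 2 → 𝒪[F]))
  have : CompactSpace (Matrix (Fin 2) (Fin 2) 𝒪[F]) :=
    inferInstanceAs (CompactSpace (Fin 2 → Fin 2 → 𝒪[F]))
  infer_instance

instance [MeasurableSpace F] [BorelSpace F] : BorelSpace Fˣ :=
  ⟨by
    have h : borel Fˣ = MeasurableSpace.comap Units.val (borel F) := by
      rw [Units.isEmbedding_val₀.eq_induced]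
      exact borel_comap (f := Units.val)
    rw [h, ← BorelSpace.measurable_eq (α := F)]
    rfl⟩

end Topology

lemma continuous_inclK {F : Type*} [Field F] [ValuativeRel F] [TopologicalSpace F] :
    Continuous (inclK (F := F)) :=
  Continuous.units_map _ <| continuous_matrix fun i j ↦
    continuous_subtype_val.comp (Continuous.matrix_elem continuous_id i j)

section SmallRadius

variable {F : Type*} [Field F] [ValuativeRel F] [TopologicalSpace F]
  [IsNonarchimedeanLocalField F]

lemma eventually_nhdsGT_zero {p : ℝ≥0 → Prop} (hp : ∀ r s, r ≤ s → p s → p r) {r : ℝ≥0}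
    (hr : 0 < r) (h : p r) : ∀ᶠ s in 𝓝[>] 0, p s :=
  Filter.mem_of_superset (Ioc_mem_nhdsGT hr) fun s hs ↦ hp s r hs.2 h

lemma eventually_nhdsGT_lt_one : ∀ᶠ r : ℝ≥0 in 𝓝[>] 0, r < 1 :=
  Filter.mem_of_superset (Ioo_mem_nhdsGT zero_lt_one) fun _ hr ↦ hr.2

lemma eventually_forall_normAbs_sub_le {x : F} {s : Set F} (hs : s ∈ 𝓝 x) :
    ∀ᶠ r : ℝ≥0 in 𝓝[>] 0, ∀ y, normAbs (y - x) ≤ r → y ∈ s := by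
  have hadd : Filter.Tendsto (fun y : F ↦ y + x) (𝓝 0) (𝓝 x) := by
    simpa using (continuous_add_const x).tendsto (0 : F)
  obtain ⟨r, hr, hrs⟩ := (hasBasis_nhds_zero_normAbs F).mem_iff.1 (hadd hs)
  refine eventually_nhdsGT_zero (fun r s hrs h y hy ↦ h y (hy.trans hrs)) (r := ⟨r, hr.le⟩) hr
    fun y hy ↦ ?_
  simpa using hrs (show y - x ∈ {x | normAbs x ≤ r} from hy)

lemma eventually_forall_normAbs_units_sub_one_le {s : Set Fˣ} (hs : s ∈ 𝓝 (1 : Fˣ)) :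
    ∀ᶠ r : ℝ≥0 in 𝓝[>] 0, ∀ y : Fˣ, normAbs ((y : F) - 1) ≤ r → y ∈ s := by
  rw [Units.isEmbedding_val₀.nhds_eq_comap] at hs
  obtain ⟨t, ht, hts⟩ := hs
  filter_upwards [eventually_forall_normAbs_sub_le ht] with r hr y hy
  exact hts (hr y (by simpa using hy))

variable {m n : Type*}

/-- The matrices that differ from `M` by entries of absolute value at most `r`. -/
def matrixBall (M : Matrix m n F) (r : ℝ≥0) : Set (Matrix m n F) :=
  {N | ∀ i j, normAbs (N i j - M i j) ≤ r}

lemma matrixBall_eq_pi (M : Matrix m n F) (r : ℝ≥0) : matrixBall M r =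
    Set.univ.pi fun i ↦ Set.univ.pi fun j ↦ Homeomorph.subRight (M i j) ⁻¹' (ball F r) := by
  ext N
  exact ⟨fun hN i _ j _ ↦ hN i j, fun hN i j ↦ hN i trivial j trivial⟩

lemma isOpen_matrixBall [Finite m] [Finite n] (M : Matrix m n F) {r : ℝ≥0} (hr : 0 < r) :
    IsOpen (matrixBall M r) := by
  rw [matrixBall_eq_pi]
  exact isOpen_set_pi Set.finite_univ fun i _ ↦ isOpen_set_pi Set.finite_univ fun j _ ↦
    (isOpen_ball hr).preimage (Homeomorph.continuous _)

lemma isCompact_matrixBall (M : Matrix m n F) {r : ℝ≥0} (hr : 0 < r) :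
    IsCompact (matrixBall M r) := by
  rw [matrixBall_eq_pi]
  exact isCompact_univ_pi fun i ↦ isCompact_univ_pi fun j ↦
    (Homeomorph.isCompact_preimage _).2 (isCompact_ball hr)

lemma eventually_matrixBall_subset [Finite m] [Finite n] {M : Matrix m n F}
    {s : Set (Matrix m n F)} (hs : s ∈ 𝓝 M) : ∀ᶠ r : ℝ≥0 in 𝓝[>] 0, matrixBall M r ⊆ s := by
  have hs' : s ∈ Filter.pi fun i ↦ 𝓝 (M i) := (nhds_pi (a := M)) ▸ hs
  obtain ⟨_, -, t, ht, hts⟩ := Filter.mem_pi.1 hs'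
  have hrow : ∀ i, ∀ᶠ r : ℝ≥0 in 𝓝[>] 0,
      ∀ w : n → F, (∀ j, normAbs (w j - M i j) ≤ r) → w ∈ t i := by
    intro i
    have hti : t i ∈ Filter.pi fun j ↦ 𝓝 (M i j) := nhds_pi (a := M i) ▸ ht i
    obtain ⟨_, -, u, hu, hut⟩ := Filter.mem_pi.1 hti
    filter_upwards [Filter.eventually_all.2 fun j ↦ eventually_forall_normAbs_sub_le (hu j)]
      with r hr w hw
    exact hut fun j _ ↦ hr j _ (hw j)
  filter_upwards [Filter.eventually_all.2 hrow] with r hr N hN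
  exact hts fun i _ ↦ hr i _ (hN i)

end SmallRadius

section Characters

lemma three_halves_mul_norm_sub_one_le {z : ℂ} (h : ‖z - 1‖ ≤ 1 / 2) :
    3 / 2 * ‖z - 1‖ ≤ ‖z ^ 2 - 1‖ := by
  have hadd : 2 ≤ ‖z + 1‖ + ‖z - 1‖ := by
    have := norm_sub_le (z + 1) (z - 1)
    rwa [show z + 1 - (z - 1) = 2 by ring, Complex.norm_ofNat] at this
  rw [show z ^ 2 - 1 = (z + 1) * (z - 1) by ring, norm_mul]
  gcongr
  linarith

lemma eq_one_of_forall_norm_pow_sub_one_le {z : ℂ} (h : ∀ n : ℕ, ‖z ^ n - 1‖ ≤ 1 / 2) :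
    z = 1 := by
  have growth : ∀ k : ℕ, (3 / 2 : ℝ) ^ k * ‖z - 1‖ ≤ ‖z ^ 2 ^ k - 1‖ := by
    intro k
    induction k with
    | zero => simp
    | succ k ih =>
      calc (3 / 2 : ℝ) ^ (k + 1) * ‖z - 1‖ = 3 / 2 * ((3 / 2) ^ k * ‖z - 1‖) := by ring
        _ ≤ 3 / 2 * ‖z ^ 2 ^ k - 1‖ := by gcongr
        _ ≤ ‖(z ^ 2 ^ k) ^ 2 - 1‖ := three_halves_mul_norm_sub_one_le (h _)
        _ = ‖z ^ 2 ^ (k + 1) - 1‖ := by rw [← pow_mul, ← pow_succ]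
  by_contra hz
  have hpos : 0 < ‖z - 1‖ := norm_pos_iff.2 (sub_ne_zero.2 hz)
  obtain ⟨k, hk⟩ := pow_unbounded_of_one_lt (1 / ‖z - 1‖) (by norm_num : (1 : ℝ) < 3 / 2)
  rw [div_lt_iff₀ hpos] at hk
  linarith [growth k, h (2 ^ k)]

variable {F : Type*} [Field F] [ValuativeRel F] [TopologicalSpace F]
  [IsNonarchimedeanLocalField F]

lemma eventually_addChar_eq_one {ψ : AddChar F Circle} (hψ : Continuous ψ) :
    ∀ᶠ r : ℝ≥0 in 𝓝[>] 0, ∀ x ∈ ball F r, ψ x = 1 := by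
  have hnear : ∀ᶠ x in 𝓝 (0 : F), ‖(ψ x : ℂ) - 1‖ ≤ 1 / 2 :=
    (by fun_prop : Continuous fun x ↦ ‖(ψ x : ℂ) - 1‖).continuousAt.eventually_mem
      (Iic_mem_nhds (by simp))
  filter_upwards [eventually_forall_normAbs_sub_le hnear] with r hr x hx
  refine Circle.coe_injective (eq_one_of_forall_norm_pow_sub_one_le fun n ↦ ?_)
  rw [← Circle.coe_pow, ← AddChar.map_nsmul_eq_pow]
  refine hr (n • x) ?_
  rw [sub_zero]
  exact (ball F r).nsmul_mem hx n

/-- The character `χ` is trivial on the units `z` with `|z - 1| ≤ r`. -/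
def IsTrivialNearOne (χ : Fˣ →* ℂˣ) (r : ℝ≥0) : Prop :=
  ∀ z : Fˣ, normAbs ((z : F) - 1) ≤ r → χ z = 1

lemma eventually_isTrivialNearOne {χ : Fˣ →* ℂˣ} (hχ : Continuous χ) :
    ∀ᶠ r : ℝ≥0 in 𝓝[>] 0, IsTrivialNearOne χ r := by
  have hnear : ∀ᶠ z in 𝓝 (1 : Fˣ), ‖(χ z : ℂ) - 1‖ ≤ 1 / 2 :=
    ((Units.continuous_val.comp hχ).sub continuous_const).norm.continuousAt.eventually_mem
      (Iic_mem_nhds (by simp))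
  filter_upwards [eventually_forall_normAbs_units_sub_one_le hnear, eventually_nhdsGT_lt_one]
    with r hr hr1 z hz
  refine Units.ext (eq_one_of_forall_norm_pow_sub_one_le fun n ↦ ?_)
  simpa using hr (z ^ n) (by
    simpa using normAbs_pow_sub_one_le r.2 (normAbs_eq_one_of_sub_one_le hr1 hz).le hz n)

end Characters

section GroupIdentities

variable {F : Type*} [Field F]

@[simp] lemma diagOne_val (a : Fˣ) : (diagOne a).val = !![(a : F), 0; 0, 1] := rfl

@[simp] lemma upperRightHom_val (x : F) :
    (upperRightHom x : GL (Fin 2) F).val = !![1, x; 0, 1] := rfl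

lemma diagOne_mul (a b : Fˣ) : diagOne (a * b) = diagOne a * diagOne b :=
  Units.ext (by simp)

lemma diagOne_one : diagOne (1 : Fˣ) = 1 :=
  Units.ext (by simp [Matrix.one_fin_two])

lemma diagOne_inv (a : Fˣ) : (diagOne a)⁻¹ = diagOne a⁻¹ := by
  rw [inv_eq_iff_mul_eq_one, ← diagOne_mul, mul_inv_cancel, diagOne_one]

lemma scalar_mul_diagOne_div_val (a d : Fˣ) :
    (Matrix.GeneralLinearGroup.scalar (Fin 2) d * diagOne (a / d)).val =
      !![(a : F), 0; 0, (d : F)] := by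
  ext i j
  fin_cases i <;> fin_cases j <;> simp [Matrix.mul_apply, mul_div_cancel₀]

lemma inv_val_fin_two (g : GL (Fin 2) F) :
    (g⁻¹).val = g.val.det⁻¹ • !![g.val 1 1, -g.val 0 1; -g.val 1 0, g.val 0 0] := by
  rw [Matrix.coe_units_inv, Matrix.inv_def, Matrix.adjugate_fin_two, Ring.inverse_eq_inv']

lemma upperRightHom_mul_apply_zero (x : F) (g : GL (Fin 2) F) (j : Fin 2) :
    (upperRightHom x * g).val 0 j = g.val 0 j + x * g.val 1 j := by
  simp [Matrix.mul_apply, Fin.sum_univ_two]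

lemma upperRightHom_mul_apply_one (x : F) (g : GL (Fin 2) F) (j : Fin 2) :
    (upperRightHom x * g).val 1 j = g.val 1 j := by
  simp [Matrix.mul_apply, Fin.sum_univ_two]

lemma diagOne_mul_upperRightHom (a : Fˣ) (x : F) :
    diagOne a * upperRightHom x = upperRightHom ((a : F) * x) * diagOne a :=
  Units.ext (by simp)

lemma upperRightHom_add_mul_diagOne (a : Fˣ) (x y : F) :
    upperRightHom (x + y) * diagOne a =
      upperRightHom x * diagOne a * upperRightHom ((a : F)⁻¹ * y) := by
  rw [mul_assoc, diagOne_mul_upperRightHom, mul_inv_cancel_left₀ a.ne_zero, ← mul_assoc,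
    AddChar.map_add_eq_mul]

lemma conj_upperRightHom_mul_diagOne_val (ϖ : Fˣ) (x : F) (k : GL (Fin 2) F) :
    ((upperRightHom (x + k.val 0 1) * diagOne ϖ)⁻¹ * k * (upperRightHom x * diagOne ϖ)).val =
      !![k.val 0 0 - (x + k.val 0 1) * k.val 1 0,
        (ϖ : F)⁻¹ * (x * ((k.val 0 0 - 1) - (k.val 1 1 - 1)) - k.val 0 1 * (k.val 1 1 - 1)
          - (x + k.val 0 1) * (k.val 1 0 * x));
        (ϖ : F) * k.val 1 0, k.val 1 0 * x + k.val 1 1] := by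
  rw [mul_inv_rev, diagOne_inv, ← AddChar.map_neg_eq_inv]
  simp only [Units.val_mul, diagOne_val, upperRightHom_val]
  rw [Matrix.eta_fin_two k.val]
  simp only [Matrix.mul_fin_two, Units.val_inv_eq_inv_val, Matrix.of_apply, Matrix.cons_val',
    Matrix.cons_val_zero, Matrix.cons_val_one, Matrix.cons_val_fin_one]
  have hϖ := ϖ.ne_zero
  ext i j
  fin_cases i <;> fin_cases j <;> simp <;> field_simp <;> ring

lemma continuous_diagOne [TopologicalSpace F] [IsTopologicalRing F] :
    Continuous (diagOne (F := F)) := by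
  have hval : Continuous fun a : Fˣ ↦ (!![(a : F), 0; 0, 1] : Matrix (Fin 2) (Fin 2) F) := by
    refine continuous_matrix fun i j ↦ ?_
    fin_cases i <;> fin_cases j <;> simp [Units.continuous_val, continuous_const]
  refine Units.continuous_iff.2 ⟨hval, ?_⟩
  simp only [diagOne_inv]
  exact hval.comp continuous_inv

end GroupIdentities

section Congruence

variable {F : Type*} [Field F] [ValuativeRel F] [TopologicalSpace F]
  [IsNonarchimedeanLocalField F]

/-- The matrix `g` is congruent to the identity modulo the ball of radius `r`. -/
def NearOne (r : ℝ≥0) (g : GL (Fin 2) F) : Prop :=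
  g.val ∈ matrixBall 1 r

lemma nearOne_iff {r : ℝ≥0} {g : GL (Fin 2) F} : NearOne r g ↔
    normAbs (g.val 0 0 - 1) ≤ r ∧ normAbs (g.val 0 1) ≤ r ∧ normAbs (g.val 1 0) ≤ r ∧
      normAbs (g.val 1 1 - 1) ≤ r := by
  simp [NearOne, matrixBall, Fin.forall_fin_two, and_assoc]

lemma nearOne_upperRightHom {r : ℝ≥0} {x : F} (hx : normAbs x ≤ r) :
    NearOne r (upperRightHom x : GL (Fin 2) F) := by
  rw [nearOne_iff]; simp [hx]

lemma nearOne_diagOne {r : ℝ≥0} {a : Fˣ} (ha : normAbs ((a : F) - 1) ≤ r) :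
    NearOne r (diagOne a) := by
  rw [nearOne_iff]; simp [ha]

lemma NearOne.normAbs_det_sub_one_le {r : ℝ≥0} (hr : r < 1) {g : GL (Fin 2) F}
    (hg : NearOne r g) : normAbs (g.val.det - 1) ≤ r := by
  obtain ⟨ha, hb, hc, hd⟩ := nearOne_iff.1 hg
  rw [Matrix.det_fin_two, sub_right_comm]
  refine normAbs_sub_le (normAbs_mul_sub_one_le (normAbs_eq_one_of_sub_one_le hr ha).le ha hd) ?_
  simpa using normAbs_mul_le (hb.trans (NNReal.coe_le_one.2 hr.le)) hc

lemma NearOne.inv {r : ℝ≥0} (hr : r < 1) {g : GL (Fin 2) F} (hg : NearOne r g) :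
    NearOne r g⁻¹ := by
  obtain ⟨ha, hb, hc, hd⟩ := nearOne_iff.1 hg
  have hdet := hg.normAbs_det_sub_one_le hr
  have hdet1 := normAbs_eq_one_of_sub_one_le hr hdet
  have hdiag : ∀ x : F, normAbs (x - 1) ≤ r → normAbs (g.val.det⁻¹ * x - 1) ≤ r := by
    intro x hx
    rw [← div_eq_inv_mul]
    exact normAbs_div_sub_one_le hr hx hdet
  rw [nearOne_iff, inv_val_fin_two]
  refine ⟨?_, ?_, ?_, ?_⟩
  · simpa using hdiag _ hd
  · simpa [hdet1] using hb
  · simpa [hdet1] using hc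
  · simpa using hdiag _ ha

lemma NearOne.mul {r : ℝ≥0} (hr : r < 1) {g h : GL (Fin 2) F} (hg : NearOne r g)
    (hh : NearOne r h) : NearOne r (g * h) := by
  have hr1 : (r : ℝ) ≤ 1 := NNReal.coe_le_one.2 hr.le
  intro i j
  have hexp : g.val * h.val - 1 = (g.val - 1) * (h.val - 1) + (g.val - 1) + (h.val - 1) := by
    noncomm_ring
  rw [← Matrix.sub_apply, Units.val_mul, hexp]
  refine normAbs_add_le (normAbs_add_le ?_ (hg i j)) (hh i j)
  rw [Matrix.mul_apply, Fin.sum_univ_two]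
  refine normAbs_add_le ?_ ?_
  · simpa using normAbs_mul_le ((hg i 0).trans hr1) (hh 0 j)
  · simpa using normAbs_mul_le ((hg i 1).trans hr1) (hh 1 j)

variable (F) in
/-- The principal congruence subgroup of radius `r`. -/
def congruenceSubgroup (r : ℝ≥0) (hr0 : 0 < r) (hr : r < 1) : OpenSubgroup (GL (Fin 2) F) where
  carrier := {g | NearOne r g}
  mul_mem' := NearOne.mul hr
  one_mem' := by simp [nearOne_iff]
  inv_mem' := NearOne.inv hr
  isOpen' := (isOpen_matrixBall 1 hr0).preimage Units.continuous_val

lemma eventually_forall_nearOne {s : Set (GL (Fin 2) F)} (hs : s ∈ 𝓝 1) :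
    ∀ᶠ r : ℝ≥0 in 𝓝[>] 0, ∀ g, NearOne r g → g ∈ s := by
  rw [Units.isInducing_embedProduct.nhds_eq_comap] at hs
  obtain ⟨t, ht, hts⟩ := hs
  obtain ⟨A, hA, B, hB, hAB⟩ := mem_nhds_prod_iff.1 ht
  have hB' : MulOpposite.op ⁻¹' B ∈ 𝓝 (1 : Matrix (Fin 2) (Fin 2) F) :=
    MulOpposite.continuous_op.continuousAt.preimage_mem_nhds (by simpa using hB)
  filter_upwards [eventually_matrixBall_subset (M := 1) (by simpa using hA),
    eventually_matrixBall_subset hB', eventually_nhdsGT_lt_one] with r hrA hrB hr1 g hg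
  exact hts (hAB ⟨hrA hg, hrB (hg.inv hr1)⟩)

lemma NearOne.conj_upperRightHom_mul_diagOne {r : ℝ≥0} {ϖ : Fˣ} (hϖ : normAbs (ϖ : F) ≤ 1)
    (hr : r ≤ normAbs (ϖ : F)) {k : GL (Fin 2) F} (hk : NearOne r k) {x : F}
    (hx : normAbs x ≤ r) :
    NearOne r
      ((upperRightHom (x + k.val 0 1) * diagOne ϖ)⁻¹ * k * (upperRightHom x * diagOne ϖ)) := by
  obtain ⟨ha, hb, hc, hd⟩ := nearOne_iff.1 hk
  have hxb : normAbs (x + k.val 0 1) ≤ r := normAbs_add_le hx hb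
  have hmul {y z : F} (hy : normAbs y ≤ r) (hz : normAbs z ≤ r) :
      normAbs (y * z) ≤ normAbs (ϖ : F) * r :=
    normAbs_mul_le (hy.trans hr) hz
  have hmul' {y z : F} (hy : normAbs y ≤ r) (hz : normAbs z ≤ r) : normAbs (y * z) ≤ r :=
    (hmul hy hz).trans (mul_le_of_le_one_left r.2 hϖ)
  rw [nearOne_iff, conj_upperRightHom_mul_diagOne_val]
  simp only [Matrix.of_apply, Matrix.cons_val', Matrix.cons_val_zero, Matrix.cons_val_one,
    Matrix.cons_val_fin_one]
  refine ⟨?_, ?_, ?_, ?_⟩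
  · rw [sub_right_comm]
    exact normAbs_sub_le ha (hmul' hxb hc)
  · rw [normAbs_mul, normAbs_inv, inv_mul_le_iff₀ (normAbs_unit_pos ϖ)]
    exact normAbs_sub_le (normAbs_sub_le (hmul hx (normAbs_sub_le ha hd)) (hmul hb hd))
      (hmul hxb (hmul' hc hx))
  · simpa using normAbs_mul_le hϖ hc
  · rw [add_sub_assoc]
    exact normAbs_add_le (hmul' hc hx) hd

end Congruence

section CosetSums

variable {A : Type*} [AddCommGroup A] {L L' : AddSubgroup A}

lemma finite_quotient_addSubgroupOf [TopologicalSpace A] [IsTopologicalAddGroup A]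
    (hL : IsCompact (L : Set A)) (hL' : IsOpen (L' : Set A)) :
    Finite (L ⧸ L'.addSubgroupOf L) :=
  have : CompactSpace L := isCompact_iff_compactSpace.1 hL
  AddSubgroup.quotient_finite_of_isOpen _ (hL'.preimage continuous_subtype_val)

variable [Fintype (L ⧸ L'.addSubgroupOf L)]

lemma sum_quotient_out_add {M : Type*} [AddCommMonoid M] {f : A → M}
    (hf : ∀ x ∈ L, ∀ y ∈ L', f (x + y) = f x) {y : A} (hy : y ∈ L) :
    ∑ q : L ⧸ L'.addSubgroupOf L, f (q.out + y) = ∑ q : L ⧸ L'.addSubgroupOf L, f q.out := by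
  rw [← Equiv.sum_comp (Equiv.addRight ((⟨y, hy⟩ : L) : L ⧸ L'.addSubgroupOf L)) fun q ↦ f q.out]
  refine Finset.sum_congr rfl fun q _ ↦ ?_
  have hq : q + ((⟨y, hy⟩ : L) : L ⧸ L'.addSubgroupOf L) =
      ((q.out + ⟨y, hy⟩ : L) : L ⧸ L'.addSubgroupOf L) := by
    rw [QuotientAddGroup.mk_add, QuotientAddGroup.out_eq']
  obtain ⟨z, hz⟩ := QuotientAddGroup.mk_out_eq_add (L'.addSubgroupOf L) (q.out + ⟨y, hy⟩)
  simp only [Equiv.coe_addRight, hq, hz]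
  exact (hf _ (L.add_mem q.out.2 hy) _ z.2).symm

lemma sum_addChar_quotient_out_eq_zero {φ : AddChar A Circle} (hφ : ∀ x ∈ L', φ x = 1) {y : A}
    (hy : y ∈ L) (hφy : φ y ≠ 1) : ∑ q : L ⧸ L'.addSubgroupOf L, (φ q.out : ℂ) = 0 := by
  have htrans : (φ y : ℂ) * ∑ q : L ⧸ L'.addSubgroupOf L, (φ q.out : ℂ) =
      ∑ q : L ⧸ L'.addSubgroupOf L, (φ q.out : ℂ) := by
    rw [Finset.mul_sum]
    refine Eq.trans (Finset.sum_congr rfl fun q _ ↦ ?_) <|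
      sum_quotient_out_add (f := fun x ↦ (φ x : ℂ))
        (fun x _ z hz ↦ by rw [AddChar.map_add_eq_mul, hφ z hz, mul_one]) hy
    rw [AddChar.map_add_eq_mul, Circle.coe_mul, mul_comm]
  by_contra h0
  exact hφy (Circle.coe_injective ((mul_eq_right₀ h0).1 htrans))

end CosetSums

section UnipotentAverage

variable {F : Type*} [Field F] {V : Type*} [AddCommGroup V] [Module ℂ V]

/-- The average of the operators `φ(x)⁻¹ π(n(x))`, where `n(x)` is unipotent upper triangular and
`x` runs over representatives of the cosets of `L'` in `L`. On Whittaker functions it cuts out the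
set of all `a` such that `ψ(a ·)` and `φ` agree on `L`. -/
def unipotentAverage (π : Representation ℂ (GL (Fin 2) F) V) (φ : AddChar F Circle)
    (L L' : AddSubgroup F) [Fintype (L ⧸ L'.addSubgroupOf L)] : V →ₗ[ℂ] V :=
  (Fintype.card (L ⧸ L'.addSubgroupOf L) : ℂ)⁻¹ •
    ∑ q : L ⧸ L'.addSubgroupOf L, (φ (-q.out) : ℂ) • π (upperRightHom (q.out : F))

variable {π : Representation ℂ (GL (Fin 2) F) V} {ψ φ : AddChar F Circle} {l : V →ₗ[ℂ] ℂ}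

lemma IsWhittakerFunctional.apply_diagOne_mul (hl : IsWhittakerFunctional π ψ l) (a : Fˣ) (x : F)
    (g : GL (Fin 2) F) (v : V) :
    l (π (diagOne a * (upperRightHom x * g)) v) = (ψ (a * x) : ℂ) * l (π (diagOne a * g) v) := by
  rw [← mul_assoc, diagOne_mul_upperRightHom, mul_assoc, map_mul π (upperRightHom _)]
  exact hl _ _

lemma IsWhittakerFunctional.apply_diagOne_upperRightHom (hl : IsWhittakerFunctional π ψ l) (a : Fˣ)
    (x : F) (v : V) :
    l (π (diagOne a) (π (upperRightHom x) v)) = (ψ (a * x) : ℂ) * l (π (diagOne a) v) := by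
  simpa using hl.apply_diagOne_mul a x 1 v

variable {L L' : AddSubgroup F} [Fintype (L ⧸ L'.addSubgroupOf L)]

lemma IsWhittakerFunctional.apply_unipotentAverage (hl : IsWhittakerFunctional π ψ l)
    (φ : AddChar F Circle) (a : Fˣ) (v : V) :
    l (π (diagOne a) (unipotentAverage π φ L L' v)) =
      (Fintype.card (L ⧸ L'.addSubgroupOf L) : ℂ)⁻¹ *
        (∑ q : L ⧸ L'.addSubgroupOf L, (φ (-q.out) * ψ (a * q.out) : ℂ)) *
          l (π (diagOne a) v) := by
  simp only [unipotentAverage, LinearMap.smul_apply, LinearMap.sum_apply, map_smul, map_sum,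
    smul_eq_mul, hl.apply_diagOne_upperRightHom, Finset.sum_mul, mul_assoc]

lemma IsWhittakerFunctional.apply_unipotentAverage_of_eq (hl : IsWhittakerFunctional π ψ l) {a : Fˣ}
    (ha : ∀ x ∈ L, ψ (a * x) = φ x) (v : V) :
    l (π (diagOne a) (unipotentAverage π φ L L' v)) = l (π (diagOne a) v) := by
  have hterm : ∀ q : L ⧸ L'.addSubgroupOf L, (φ (-q.out) * ψ (a * q.out) : ℂ) = 1 := fun q ↦ by
    rw [ha _ q.out.2, ← Circle.coe_mul, ← AddChar.map_add_eq_mul, neg_add_cancel,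
      AddChar.map_zero_eq_one, Circle.coe_one]
  rw [hl.apply_unipotentAverage, Finset.sum_congr rfl fun q _ ↦ hterm q, Finset.sum_const,
    Finset.card_univ, nsmul_one, inv_mul_cancel₀ (by exact_mod_cast Fintype.card_ne_zero), one_mul]

lemma IsWhittakerFunctional.apply_unipotentAverage_of_ne (hl : IsWhittakerFunctional π ψ l) {a : Fˣ}
    (ha : ∀ x ∈ L', ψ (a * x) = φ x) {y : F} (hy : y ∈ L) (hay : ψ (a * y) ≠ φ y) (v : V) :
    l (π (diagOne a) (unipotentAverage π φ L L' v)) = 0 := by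
  let χ : AddChar F Circle := φ⁻¹ * ψ.mulShift a
  have hχ : ∀ x, χ x = φ (-x) * ψ (a * x) := fun x ↦ rfl
  have hχ1 : ∀ x, χ x = 1 ↔ ψ (a * x) = φ x := fun x ↦ by
    rw [hχ, AddChar.map_neg_eq_inv, inv_mul_eq_one, eq_comm]
  have hsum := sum_addChar_quotient_out_eq_zero (φ := χ) (L := L) (L' := L')
    (fun x hx ↦ (hχ1 x).2 (ha x hx)) hy (mt (hχ1 y).1 hay)
  simp only [hχ, Circle.coe_mul] at hsum
  rw [hl.apply_unipotentAverage, hsum, mul_zero, zero_mul]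

end UnipotentAverage

section Admissible

variable {F : Type*} [Field F] [TopologicalSpace F] {V : Type*} [AddCommGroup V] [Module ℂ V]

/-- A smooth representation: every vector has an open stabilizer. -/
def IsSmooth (π : Representation ℂ (GL (Fin 2) F) V) : Prop :=
  ∀ v : V, ∃ U : OpenSubgroup (GL (Fin 2) F), v ∈ fixedVectors π U

/-- An admissible smooth representation, not necessarily irreducible. -/
structure IsAdmissible (π : Representation ℂ (GL (Fin 2) F) V) : Prop where
  smooth : IsSmooth π
  finiteDimensional_fixedVectors :
    ∀ U : OpenSubgroup (GL (Fin 2) F), FiniteDimensional ℂ (fixedVectors π U)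

variable {π : Representation ℂ (GL (Fin 2) F) V}

lemma IsIrredAdmissible.isAdmissible (hπ : IsIrredAdmissible π) : IsAdmissible π :=
  ⟨hπ.smooth, hπ.admissible⟩

lemma IsSmooth.continuous_whittaker [IsTopologicalRing F] (hπ : IsSmooth π) (l : V →ₗ[ℂ] ℂ)
    (v : V) : Continuous fun g : GL (Fin 2) F ↦ l (π g v) := by
  obtain ⟨U, hU⟩ := hπ v
  refine IsLocallyConstant.continuous ((IsLocallyConstant.iff_exists_open _).2 fun g ↦ ?_)
  refine ⟨(fun h ↦ g⁻¹ * h) ⁻¹' (U : Set (GL (Fin 2) F)),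
    U.isOpen.preimage (continuous_const_mul _), by simp, fun h hh ↦ ?_⟩
  have hh' : π (g⁻¹ * h) v = v := hU _ hh
  rw [← mul_inv_cancel_left g h, map_mul, Module.End.mul_apply, hh']

end Admissible

section Fixed

variable {F : Type*} [Field F] [ValuativeRel F] [TopologicalSpace F]
  [IsNonarchimedeanLocalField F] {V : Type*} [AddCommGroup V] [Module ℂ V]

/-- The vector `v` is fixed by all matrices congruent to the identity modulo the ball of radius
`r`. -/
def IsFixed (π : Representation ℂ (GL (Fin 2) F) V) (r : ℝ≥0) (v : V) : Prop :=
  ∀ g, NearOne r g → π g v = v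

variable {π : Representation ℂ (GL (Fin 2) F) V} {ψ : AddChar F Circle} {l : V →ₗ[ℂ] ℂ}
  {r : ℝ≥0} {v : V}

lemma IsSmooth.eventually_isFixed (hπ : IsSmooth π) (v : V) :
    ∀ᶠ r : ℝ≥0 in 𝓝[>] 0, IsFixed π r v := by
  obtain ⟨U, hU⟩ := hπ v
  filter_upwards [eventually_forall_nearOne (U.isOpen.mem_nhds U.one_mem)] with r hr g hg
  exact hU g (hr g hg)

lemma IsFixed.apply_mul (h : IsFixed π r v) {k : GL (Fin 2) F} (hk : NearOne r k)
    (g : GL (Fin 2) F) : π (g * k) v = π g v := by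
  rw [map_mul, Module.End.mul_apply, h k hk]

lemma IsFixed.addChar_mul_eq_one (h : IsFixed π r v) (hl : IsWhittakerFunctional π ψ l) {a : Fˣ}
    (ha : l (π (diagOne a) v) ≠ 0) {x : F} (hx : x ∈ ball F r) : ψ (a * x) = 1 := by
  have heq := hl.apply_diagOne_upperRightHom a x v
  rw [h _ (nearOne_upperRightHom hx)] at heq
  exact Circle.coe_injective ((mul_eq_right₀ ha).1 heq.symm)

lemma IsFixed.exists_forall_lt_whittaker_eq_zero (hr : 0 < r) (h : IsFixed π r v)
    (hl : IsWhittakerFunctional π ψ l) (hψ1 : ψ ≠ 1) :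
    ∃ C : ℝ, ∀ a : Fˣ, C < normAbs (a : F) → l (π (diagOne a) v) = 0 := by
  obtain ⟨y, hy⟩ := AddChar.ne_one_iff.1 hψ1
  refine ⟨normAbs y / r, fun a ha ↦ by_contra fun hne ↦ hy ?_⟩
  have hx : normAbs ((a : F)⁻¹ * y) ≤ r := by
    rw [normAbs_mul, normAbs_inv, inv_mul_le_iff₀ (normAbs_unit_pos a)]
    exact ((div_lt_iff₀ (NNReal.coe_pos.2 hr)).1 ha).le
  simpa using h.addChar_mul_eq_one hl hne hx

end Fixed

section HeckeOperator

variable {F : Type*} [Field F] [ValuativeRel F] [TopologicalSpace F]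
  [IsNonarchimedeanLocalField F] {V : Type*} [AddCommGroup V] [Module ℂ V]

/-- The subgroup `ϖ • B`, where `B` is the ball of radius `r`. -/
def scaledBall (ϖ : Fˣ) (r : ℝ≥0) : AddSubgroup F :=
  (ball F r).comap (AddMonoidHom.mulLeft (ϖ : F)⁻¹)

/-- The average of the operators `π(n(x) diag(ϖ, 1))`, where `x` runs over representatives of the
cosets of `ϖ • B` in the ball `B` of radius `r`. On vectors fixed at level `r` it is a normalized
Hecke operator, which translates Whittaker functions by `ϖ` near zero. -/
def heckeOperator (π : Representation ℂ (GL (Fin 2) F) V) (ϖ : Fˣ) (r : ℝ≥0)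
    [Fintype (ball F r ⧸ (scaledBall ϖ r).addSubgroupOf (ball F r))] : V →ₗ[ℂ] V :=
  unipotentAverage π 1 (ball F r) (scaledBall ϖ r) ∘ₗ π (diagOne ϖ)

lemma isOpen_scaledBall (ϖ : Fˣ) {r : ℝ≥0} (hr : 0 < r) : IsOpen (scaledBall ϖ r : Set F) :=
  (isOpen_ball hr).preimage (continuous_const_mul _)

variable {π : Representation ℂ (GL (Fin 2) F) V} {ψ : AddChar F Circle} {l : V →ₗ[ℂ] ℂ}
  {r : ℝ≥0} {ϖ : Fˣ} {v : V} [Fintype (ball F r ⧸ (scaledBall ϖ r).addSubgroupOf (ball F r))]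

lemma heckeOperator_apply (v : V) : heckeOperator π ϖ r v =
    (Fintype.card (ball F r ⧸ (scaledBall ϖ r).addSubgroupOf (ball F r)) : ℂ)⁻¹ •
      ∑ q : ball F r ⧸ (scaledBall ϖ r).addSubgroupOf (ball F r),
        π (upperRightHom (q.out : F) * diagOne ϖ) v := by
  simp [heckeOperator, unipotentAverage]

lemma IsFixed.heckeOperator (hϖ : normAbs (ϖ : F) ≤ 1) (hr : r ≤ normAbs (ϖ : F))
    (h : IsFixed π r v) : IsFixed π r (heckeOperator π ϖ r v) := by
  intro k hk
  have hb : k.val 0 1 ∈ ball F r := (nearOne_iff.1 hk).2.1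
  have hperiodic : ∀ x ∈ ball F r, ∀ y ∈ scaledBall ϖ r,
      π (upperRightHom (x + y) * diagOne ϖ) v = π (upperRightHom x * diagOne ϖ) v := by
    intro x _ y hy
    rw [upperRightHom_add_mul_diagOne]
    exact h.apply_mul (nearOne_upperRightHom hy) _
  have hmove : ∀ x ∈ ball F r, π k (π (upperRightHom x * diagOne ϖ) v) =
      π (upperRightHom (x + k.val 0 1) * diagOne ϖ) v := by
    intro x hx
    rw [← h.apply_mul (hk.conj_upperRightHom_mul_diagOne hϖ hr hx)
      (upperRightHom (x + k.val 0 1) * diagOne ϖ), ← Module.End.mul_apply, ← map_mul,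
      mul_assoc _⁻¹, mul_inv_cancel_left]
  rw [heckeOperator_apply, map_smul, map_sum,
    ← sum_quotient_out_add (f := fun x ↦ π (upperRightHom x * diagOne ϖ) v) hperiodic hb]
  exact congrArg _ (Finset.sum_congr rfl fun q _ ↦ hmove _ q.out.2)

lemma IsWhittakerFunctional.apply_heckeOperator (hl : IsWhittakerFunctional π ψ l) {a : Fˣ}
    (ha : ∀ x ∈ ball F r, ψ (a * x) = 1) (v : V) :
    l (π (diagOne a) (heckeOperator π ϖ r v)) = l (π (diagOne (a * ϖ)) v) := by
  rw [heckeOperator, LinearMap.comp_apply, hl.apply_unipotentAverage_of_eq ha, diagOne_mul,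
    map_mul, Module.End.mul_apply]

lemma IsWhittakerFunctional.apply_heckeOperator_pow (hl : IsWhittakerFunctional π ψ l)
    (hϖ : normAbs (ϖ : F) ≤ 1) {a : Fˣ} (ha : ∀ x ∈ ball F r, ψ (a * x) = 1) (n : ℕ) (v : V) :
    l (π (diagOne a) ((heckeOperator π ϖ r ^ n) v)) = l (π (diagOne (a * ϖ ^ n)) v) := by
  induction n generalizing a with
  | zero => simp
  | succ n ih =>
    have hshift : ∀ x ∈ ball F r, ψ ((a * ϖ : Fˣ) * x) = 1 := fun x hx ↦ by
      rw [Units.val_mul, mul_assoc]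
      exact ha _ (mem_ball.2 (by simpa using normAbs_mul_le hϖ hx))
    rw [pow_succ', Module.End.mul_apply, hl.apply_heckeOperator ha, ih hshift, mul_assoc,
      ← pow_succ']

end HeckeOperator

section Growth

lemma exists_norm_pow_apply_le {E : Type*} [AddCommGroup E] [Module ℂ E] [FiniteDimensional ℂ E]
    (T : E →ₗ[ℂ] E) {ι : Type*} (φ : ι → E →ₗ[ℂ] ℂ) (hφ : ∀ w, ∃ C : ℝ, ∀ i, ‖φ i w‖ ≤ C) (v : E) :
    ∃ (C : ℝ) (R : ℝ≥0), ∀ (n : ℕ) (i : ι), ‖φ i ((T ^ n) v)‖ ≤ C * R ^ n := by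
  let e := (Module.finBasis ℂ E).equivFun
  let : NormedAddCommGroup E := NormedAddCommGroup.induced E _ e.toLinearMap e.injective
  let : NormedSpace ℂ E := NormedSpace.induced ℂ E _ e.toLinearMap
  have : CompleteSpace E := FiniteDimensional.complete ℂ E
  obtain ⟨C, hC⟩ := banach_steinhaus (g := fun i ↦ (φ i).toContinuousLinearMap) hφ
  let T' := Module.End.toContinuousLinearMap E T
  refine ⟨C * ‖v‖, ‖T'‖₊, fun n i ↦ ?_⟩
  have hpow : ‖(T ^ n) v‖ ≤ ‖T'‖ ^ n * ‖v‖ := by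
    induction n with
    | zero => simp
    | succ n ih =>
      rw [pow_succ', Module.End.mul_apply, pow_succ', mul_assoc]
      exact T'.le_opNorm_of_le ih
  calc ‖φ i ((T ^ n) v)‖ ≤ C * ‖(T ^ n) v‖ :=
        (φ i).toContinuousLinearMap.le_of_opNorm_le (hC i) _
    _ ≤ C * (‖T'‖ ^ n * ‖v‖) := by
      gcongr
      exact (norm_nonneg _).trans (hC i)
    _ = C * ‖v‖ * (‖T'‖₊ : ℝ) ^ n := by rw [coe_nnnorm]; ring

variable {F : Type*} [Field F] [ValuativeRel F] [TopologicalSpace F]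
  [IsNonarchimedeanLocalField F]

variable (F) in
/-- The closed annulus `c ≤ |a| ≤ C` in `Fˣ`. -/
def annulus (c C : ℝ) : Set Fˣ :=
  {a | c ≤ normAbs (a : F) ∧ normAbs (a : F) ≤ C}

lemma isCompact_annulus {c C : ℝ} (hc : 0 < c) : IsCompact (annulus F c C) := by
  rcases le_or_gt C 0 with hC | hC
  · convert isCompact_empty
    exact Set.eq_empty_of_forall_notMem fun a ha ↦ (ha.2.trans hC).not_gt (normAbs_unit_pos a)
  lift C to ℝ≥0 using hC.le
  lift c to ℝ≥0 using hc.le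
  convert Units.isClosedEmbedding_embedProduct (α := F).isCompact_preimage
    ((isCompact_ball (NNReal.coe_pos.1 hC)).prod
      ((isCompact_ball (inv_pos.2 (NNReal.coe_pos.1 hc))).image MulOpposite.continuous_op)) using 1
  ext a
  simp only [annulus, Set.mem_ofPred_eq, Set.mem_preimage, Units.embedProduct_apply, Set.mem_prod,
    SetLike.mem_coe, mem_ball, Set.mem_image, MulOpposite.op_inj, exists_eq_right,
    Units.val_inv_eq_inv_val, normAbs_inv, NNReal.coe_inv]
  rw [inv_le_inv₀ (normAbs_unit_pos a) hc, and_comm]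

lemma exists_forall_addChar_mul_eq_one {ψ : AddChar F Circle} (hψ : Continuous ψ) {r : ℝ≥0}
    (hr : 0 < r) : ∃ c : ℝ, 0 < c ∧ ∀ a : F, normAbs a ≤ c → ∀ x ∈ ball F r, ψ (a * x) = 1 := by
  obtain ⟨δ, hδψ, hδ⟩ := ((eventually_addChar_eq_one hψ).and self_mem_nhdsWithin).exists
  have hr' : (0 : ℝ) < r := hr
  refine ⟨δ / r, div_pos hδ hr', fun a ha x hx ↦ hδψ _ ?_⟩
  exact (normAbs_mul_le ha hx).trans_eq (div_mul_cancel₀ _ hr'.ne')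

variable {V : Type*} [AddCommGroup V] [Module ℂ V]
  {π : Representation ℂ (GL (Fin 2) F) V} {ψ : AddChar F Circle} {l : V →ₗ[ℂ] ℂ}

lemma IsAdmissible.exists_norm_whittaker_le (hπ : IsAdmissible π) (hψ : Continuous ψ)
    (hl : IsWhittakerFunctional π ψ l) {ϖ : Fˣ} (hϖ : normAbs (ϖ : F) < 1) (v : V) :
    ∃ (c C : ℝ) (R : ℝ≥0), 0 < c ∧ ∀ (n : ℕ), ∀ a ∈ annulus F (normAbs (ϖ : F) * c) c,
      ‖l (π (diagOne (a * ϖ ^ n)) v)‖ ≤ C * R ^ n := by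
  have hsmall : ∀ᶠ r : ℝ≥0 in 𝓝[>] 0, r ≤ normAbs (ϖ : F) :=
    eventually_nhdsGT_zero (fun r s hrs hs ↦ (NNReal.coe_le_coe.2 hrs).trans hs)
      (r := ⟨_, normAbs_nonneg _⟩) (normAbs_unit_pos ϖ) le_rfl
  obtain ⟨r, ⟨hfix, hrϖ⟩, hr0⟩ :=
    (((hπ.smooth.eventually_isFixed v).and hsmall).and self_mem_nhdsWithin).exists
  obtain ⟨c, hc, hψc⟩ := exists_forall_addChar_mul_eq_one hψ hr0
  let E := fixedVectors π (congruenceSubgroup F r hr0 (by exact_mod_cast hrϖ.trans_lt hϖ))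
  have : FiniteDimensional ℂ E := hπ.finiteDimensional_fixedVectors _
  have : Finite (ball F r ⧸ (scaledBall ϖ r).addSubgroupOf (ball F r)) :=
    finite_quotient_addSubgroupOf (isCompact_ball hr0) (isOpen_scaledBall ϖ hr0)
  let := Fintype.ofFinite (ball F r ⧸ (scaledBall ϖ r).addSubgroupOf (ball F r))
  have hE : ∀ w ∈ E, heckeOperator π ϖ r w ∈ E := fun w hw ↦ IsFixed.heckeOperator hϖ.le hrϖ hw
  have hbdd : ∀ w, ∃ C : ℝ, ∀ a : annulus F (normAbs (ϖ : F) * c) c,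
      ‖l (π (diagOne (a : Fˣ)) w)‖ ≤ C := by
    intro w
    obtain ⟨C, hC⟩ := (isCompact_annulus
      (mul_pos (normAbs_unit_pos ϖ) hc)).exists_bound_of_continuousOn
        ((hπ.smooth.continuous_whittaker l w).comp continuous_diagOne).continuousOn
    exact ⟨C, fun a ↦ hC a a.2⟩
  obtain ⟨C, R, hCR⟩ := exists_norm_pow_apply_le ((heckeOperator π ϖ r).restrict hE)
    (fun a : annulus F (normAbs (ϖ : F) * c) c ↦ l ∘ₗ π (diagOne (a : Fˣ)) ∘ₗ E.subtype)
    (fun w ↦ hbdd w) ⟨v, hfix⟩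
  refine ⟨c, C, R, hc, fun n a ha ↦ ?_⟩
  rw [← hl.apply_heckeOperator_pow hϖ.le (hψc a ha.2)]
  simpa [Module.End.pow_restrict n hE] using hCR n ⟨a, ha⟩

end Growth

section AbsPow

variable {F : Type*} [Field F] [ValuativeRel F] [TopologicalSpace F]
  [IsNonarchimedeanLocalField F]

lemma continuous_normAbs_units : Continuous fun a : Fˣ ↦ normAbs (a : F) := by
  refine IsLocallyConstant.continuous ((IsLocallyConstant.iff_eventually_eq _).2 fun a ↦ ?_)
  have hsub : Filter.Tendsto (fun y : Fˣ ↦ (y - a : F)) (𝓝 a) (𝓝 0) := by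
    simpa using (Units.continuous_val.tendsto a).sub_const (a : F)
  filter_upwards [hsub ((hasBasis_nhds_zero_normAbs F).mem_of_mem (half_pos (normAbs_unit_pos a)))]
    with y hy
  exact normAbs_eq_of_sub_lt (lt_of_le_of_lt hy (half_lt_self (normAbs_unit_pos a)))

lemma continuous_absPow (s : ℂ) : Continuous fun a : Fˣ ↦ absPow a s :=
  (Complex.continuous_ofReal.comp continuous_normAbs_units).cpow continuous_const fun a ↦
    Complex.ofReal_mem_slitPlane.2 (normAbs_unit_pos a)

lemma norm_absPow (a : Fˣ) (s : ℂ) : ‖absPow a s‖ = normAbs (a : F) ^ s.re := by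
  rw [absPow, Complex.norm_cpow_eq_rpow_re_of_pos (normAbs_unit_pos a)]

lemma absPow_mul (a b : Fˣ) (s : ℂ) : absPow (a * b) s = absPow a s * absPow b s := by
  rw [absPow, Units.val_mul, normAbs_mul, Complex.ofReal_mul,
    Complex.mul_cpow_ofReal_nonneg (normAbs_nonneg _) (normAbs_nonneg _), absPow, absPow]

lemma absPow_eq_one {a : Fˣ} (ha : normAbs (a : F) = 1) (s : ℂ) : absPow a s = 1 := by
  rw [absPow, ha, Complex.ofReal_one, Complex.one_cpow]

lemma absPow_pow (a : Fˣ) (n : ℕ) (s : ℂ) : absPow (a ^ n) s = absPow a s ^ n := by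
  induction n with
  | zero => simpa using absPow_eq_one (a := (1 : Fˣ)) (by simp) s
  | succ n ih => rw [pow_succ, absPow_mul, ih, pow_succ]

end AbsPow

section Convergence

lemma integrableOn_iUnion_preimage_mul_pow {G E : Type*} [Group G] [TopologicalSpace G]
    [IsTopologicalGroup G] [T2Space G] [MeasurableSpace G] [BorelSpace G] [NormedAddCommGroup E]
    (m : Measure G) [IsFiniteMeasureOnCompacts m] [m.IsMulRightInvariant] {f : G → E}
    (hf : Continuous f) {S : Set G} (hS : IsCompact S) {g : G} {A : ℝ} {ρ : ℝ} (hρ0 : 0 ≤ ρ)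
    (hρ1 : ρ < 1) (hbound : ∀ (n : ℕ), ∀ b ∈ S, ‖f (b * g ^ n)‖ ≤ A * ρ ^ n) :
    IntegrableOn f (⋃ n : ℕ, (· * (g ^ n)⁻¹) ⁻¹' S) m := by
  have hcompact : ∀ n : ℕ, IsCompact ((· * (g ^ n)⁻¹) ⁻¹' S) := fun n ↦
    (Homeomorph.mulRight (g ^ n)⁻¹).isCompact_preimage.2 hS
  refine integrableOn_iUnion_of_summable_integral_norm
    (fun n ↦ hf.continuousOn.integrableOn_compact (hcompact n)) ?_
  refine Summable.of_nonneg_of_le (fun n ↦ integral_nonneg fun _ ↦ norm_nonneg _) (fun n ↦ ?_)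
    ((summable_geometric_of_lt_one hρ0 hρ1).mul_left (A * m.real S))
  have hle := norm_setIntegral_le_of_norm_le_const (μ := m) (f := fun a ↦ ‖f a‖)
    (C := A * ρ ^ n) (hcompact n).measure_lt_top fun a ha ↦ by
      simpa using hbound n _ ha
  rw [Real.norm_of_nonneg (integral_nonneg fun _ ↦ norm_nonneg _), measureReal_def,
    measure_preimage_mul_right, ← measureReal_def] at hle
  exact hle.trans_eq (by ring)

variable {F : Type*} [Field F] [ValuativeRel F] [TopologicalSpace F]
  [IsNonarchimedeanLocalField F]

lemma exists_mul_pow_inv_mem_annulus {ϖ : Fˣ} (hϖ : normAbs (ϖ : F) < 1) {c : ℝ} (hc : 0 < c)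
    {a : Fˣ} (ha : normAbs (a : F) ≤ c) :
    ∃ n : ℕ, a * (ϖ ^ n)⁻¹ ∈ annulus F (normAbs (ϖ : F) * c) c := by
  obtain ⟨n, hlt, hle⟩ := exists_nat_pow_near_of_lt_one (div_pos (normAbs_unit_pos a) hc)
    ((div_le_one hc).2 ha) (normAbs_unit_pos ϖ) hϖ
  rw [div_le_iff₀ hc] at hle
  rw [lt_div_iff₀ hc, pow_succ] at hlt
  have hp : 0 < normAbs (ϖ : F) ^ n := pow_pos (normAbs_unit_pos ϖ) n
  refine ⟨n, ?_, ?_⟩ <;>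
    simp only [Units.val_mul, Units.val_inv_eq_inv_val, normAbs_mul, normAbs_inv,
      Units.val_pow_eq_pow_val, normAbs_pow]
  · rw [le_mul_inv_iff₀ hp]; linarith
  · rw [mul_inv_le_iff₀ hp]; linarith

lemma zetaIntegrand_mul_pow (W : GL (Fin 2) F → ℂ) (χ : Fˣ →* ℂˣ) (s : ℂ) (b ϖ : Fˣ) (n : ℕ) :
    zetaIntegrand W χ s (b * ϖ ^ n) = W (diagOne (b * ϖ ^ n)) *
      ((χ b : ℂ) * absPow b (s - 1 / 2)) * ((χ ϖ : ℂ) * absPow ϖ (s - 1 / 2)) ^ n := by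
  simp only [zetaIntegrand, absPow_mul, absPow_pow, map_mul, map_pow, Units.val_mul,
    Units.val_pow_eq_pow_val]
  ring

lemma exists_forall_mul_norm_absPow_lt_one {ϖ : Fˣ} (hϖ : normAbs (ϖ : F) < 1) (χ : Fˣ →* ℂˣ)
    (R : ℝ) : ∃ σ : ℝ, ∀ s : ℂ, σ < s.re → R * ‖(χ ϖ : ℂ) * absPow ϖ (s - 1 / 2)‖ < 1 := by
  have hlim : Filter.Tendsto (fun t : ℝ ↦ R * (‖(χ ϖ : ℂ)‖ * normAbs (ϖ : F) ^ (t - 1 / 2)))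
      Filter.atTop (𝓝 0) := by
    have hpow := (tendsto_rpow_atTop_of_base_lt_one _
      ((neg_one_lt_zero).trans (normAbs_unit_pos ϖ)) hϖ).comp
        (Filter.tendsto_atTop_add_const_right _ (-(1 / 2) : ℝ) Filter.tendsto_id)
    simpa [sub_eq_add_neg] using (hpow.const_mul ‖(χ ϖ : ℂ)‖).const_mul R
  obtain ⟨σ, hσ⟩ := Filter.eventually_atTop.1 (hlim.eventually_lt_const one_pos)
  refine ⟨σ, fun s hs ↦ ?_⟩
  simpa [norm_absPow] using hσ s.re hs.le

variable {V : Type*} [AddCommGroup V] [Module ℂ V]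
  {π : Representation ℂ (GL (Fin 2) F) V} {ψ : AddChar F Circle} {l : V →ₗ[ℂ] ℂ}

lemma IsSmooth.continuous_zetaIntegrand (hπ : IsSmooth π) {χ : Fˣ →* ℂˣ} (hχ : Continuous χ)
    (v : V) (s : ℂ) : Continuous (zetaIntegrand (fun g ↦ l (π g v)) χ s) :=
  (((hπ.continuous_whittaker l v).comp continuous_diagOne).mul
    (Units.continuous_val.comp hχ)).mul (continuous_absPow _)

variable [MeasurableSpace F] [BorelSpace F]

lemma IsAdmissible.exists_zetaConverges (dm : Measure Fˣ) [dm.IsHaarMeasure] (hπ : IsAdmissible π)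
    (hψ : Continuous ψ) (hψ1 : ψ ≠ 1) (hl : IsWhittakerFunctional π ψ l)
    {χ : Fˣ →* ℂˣ} (hχ : Continuous χ) (v : V) :
    ∃ σ : ℝ, ∀ s : ℂ, σ < s.re → ZetaConverges dm (fun g ↦ l (π g v)) χ s := by
  obtain ⟨ϖ, hϖ⟩ := exists_normAbs_lt_one F
  obtain ⟨c, C, R, hc, hgrowth⟩ := hπ.exists_norm_whittaker_le hψ hl hϖ v
  obtain ⟨r, hfix, hr0⟩ := ((hπ.smooth.eventually_isFixed v).and self_mem_nhdsWithin).exists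
  obtain ⟨B, hB⟩ := hfix.exists_forall_lt_whittaker_eq_zero hr0 hl hψ1
  obtain ⟨σ, hσ⟩ := exists_forall_mul_norm_absPow_lt_one hϖ χ R
  refine ⟨σ, fun s hs ↦ ?_⟩
  have hcont := hπ.smooth.continuous_zetaIntegrand (l := l) hχ v s
  have hcompact : IsCompact (annulus F (normAbs (ϖ : F) * c) c) :=
    isCompact_annulus (mul_pos (normAbs_unit_pos ϖ) hc)
  obtain ⟨D, hD⟩ := hcompact.exists_bound_of_continuousOn
    ((Units.continuous_val.comp hχ).mul (continuous_absPow (s - 1 / 2))).continuousOn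
  have hbound : ∀ n : ℕ, ∀ b ∈ annulus F (normAbs (ϖ : F) * c) c,
      ‖zetaIntegrand (fun g ↦ l (π g v)) χ s (b * ϖ ^ n)‖ ≤
        C * D * (R * ‖(χ ϖ : ℂ) * absPow ϖ (s - 1 / 2)‖) ^ n := by
    intro n b hb
    rw [zetaIntegrand_mul_pow, norm_mul, norm_mul, norm_pow, mul_pow]
    calc _ ≤ C * R ^ n * D * ‖(χ ϖ : ℂ) * absPow ϖ (s - 1 / 2)‖ ^ n := by
          gcongr
          · exact (norm_nonneg _).trans (hgrowth n b hb)
          · exact hgrowth n b hb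
          · exact hD b hb
      _ = _ := by ring
  have hnear := integrableOn_iUnion_preimage_mul_pow dm hcont hcompact (by positivity) (hσ s hs)
    hbound
  have hfar : IntegrableOn (zetaIntegrand (fun g ↦ l (π g v)) χ s) (annulus F c B) dm :=
    hcont.continuousOn.integrableOn_compact (isCompact_annulus hc)
  refine (integrableOn_iff_integrable_of_support_subset fun a ha ↦ ?_).1 (hnear.union hfar)
  rcases le_total (normAbs (a : F)) c with hac | hac
  · exact Or.inl (Set.mem_iUnion.2 (exists_mul_pow_inv_mem_annulus hϖ hc hac))
  · refine Or.inr ⟨hac, not_lt.1 fun hBa ↦ ha ?_⟩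
    simp only [zetaIntegrand, hB a hBa, zero_mul]

end Convergence

section OrbitPoint

variable {F : Type*} [Field F] [ValuativeRel F]

lemma orbitPoint_fst_apply (u v : F) (e : Fˣ) (k₁ k₂ : maxCompact F) (i j : Fin 2) :
    (orbitPoint u v e k₁ k₂).1 i j =
      (e : F)⁻¹ * (((upperRightHom u * inclK k₁)⁻¹).val i 0 *
        (upperRightHom v * inclK k₂).val 0 j) := by
  rw [upperRightHom_mul_apply_zero, mul_inv_rev, ← AddChar.map_neg_eq_inv]
  simp only [orbitPoint, Units.val_mul, upperRightHom_val, Matrix.mul_apply, Fin.sum_univ_two,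
    Matrix.of_apply, Matrix.cons_val', Matrix.cons_val_fin_one, Matrix.cons_val_zero,
    Matrix.cons_val_one]
  ring

lemma orbitPoint_snd_apply (u v : F) (e : Fˣ) (k₁ k₂ : maxCompact F) (i j : Fin 2) :
    (orbitPoint u v e k₁ k₂).2 i j =
      (e : F) * (((upperRightHom u * inclK k₁)⁻¹).val i 1 *
        (upperRightHom v * inclK k₂).val 1 j) := by
  rw [upperRightHom_mul_apply_one, mul_inv_rev, ← AddChar.map_neg_eq_inv]
  simp only [orbitPoint, Units.val_mul, upperRightHom_val, Matrix.mul_apply, Fin.sum_univ_two,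
    Matrix.of_apply, Matrix.cons_val', Matrix.cons_val_fin_one, Matrix.cons_val_zero,
    Matrix.cons_val_one]
  ring

end OrbitPoint

section Orbit

variable {F : Type*} [Field F] [ValuativeRel F] [TopologicalSpace F]
  [IsNonarchimedeanLocalField F]

lemma normAbs_inclK_le_one (k : maxCompact F) (i j : Fin 2) : normAbs ((inclK k).val i j) ≤ 1 :=
  normAbs_integer (k.val i j)

lemma normAbs_det_inclK (k : maxCompact F) : normAbs (inclK k).val.det = 1 := by
  have hle : ∀ k : maxCompact F, normAbs (inclK k).val.det ≤ 1 := fun k ↦ by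
    rw [Matrix.det_fin_two]
    refine normAbs_sub_le ?_ ?_ <;>
      simpa using normAbs_mul_le (normAbs_inclK_le_one k _ _) (normAbs_inclK_le_one k _ _)
  refine le_antisymm (hle k) ?_
  have hmul : normAbs (inclK k).val.det * normAbs (inclK k⁻¹).val.det = 1 := by
    rw [← normAbs_mul, ← Matrix.det_mul, ← Units.val_mul, ← map_mul, mul_inv_cancel, map_one,
      Units.val_one, Matrix.det_one, normAbs_one]
  rw [← hmul]
  exact mul_le_of_le_one_right (normAbs_nonneg _) (hle k⁻¹)

lemma normAbs_inclK_one_one {k : maxCompact F}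
    (h : normAbs ((inclK k).val 1 0) ≤ normAbs ((inclK k).val 1 1)) :
    normAbs ((inclK k).val 1 1) = 1 := by
  refine le_antisymm (normAbs_inclK_le_one k 1 1) ?_
  rw [← normAbs_det_inclK k, Matrix.det_fin_two]
  refine normAbs_sub_le ?_ ?_
  · simpa using normAbs_mul_le (normAbs_inclK_le_one k 0 0) le_rfl
  · simpa using normAbs_mul_le (normAbs_inclK_le_one k 0 1) h

/-- The matrix `g` has the unit diagonal entries `a` and `d`, and it is diagonal modulo the ball of
radius `r`. -/
structure NearDiagonal (r : ℝ≥0) (a d : Fˣ) (g : GL (Fin 2) F) : Prop where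
  apply_zero_zero : g.val 0 0 = a
  apply_one_one : g.val 1 1 = d
  normAbs_left : normAbs (a : F) = 1
  normAbs_right : normAbs (d : F) = 1
  normAbs_apply_zero_one : normAbs (g.val 0 1) ≤ r
  normAbs_apply_one_zero : normAbs (g.val 1 0) ≤ r

lemma NearDiagonal.exists_eq_scalar_mul_diagOne_mul {r : ℝ≥0} {a d : Fˣ} {g : GL (Fin 2) F}
    (hg : NearDiagonal r a d g) : ∃ k, NearOne r k ∧
      g = Matrix.GeneralLinearGroup.scalar (Fin 2) d * diagOne (a / d) * k := by
  refine ⟨(Matrix.GeneralLinearGroup.scalar (Fin 2) d * diagOne (a / d))⁻¹ * g, ?_,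
    (mul_inv_cancel_left _ _).symm⟩
  have hval : ((Matrix.GeneralLinearGroup.scalar (Fin 2) d * diagOne (a / d))⁻¹ * g).val =
      !![1, (a : F)⁻¹ * g.val 0 1; (d : F)⁻¹ * g.val 1 0, 1] := by
    refine (Units.mul_right_inj (Matrix.GeneralLinearGroup.scalar (Fin 2) d *
      diagOne (a / d))).1 ?_
    rw [← Units.val_mul, mul_inv_cancel_left, scalar_mul_diagOne_div_val, Matrix.mul_fin_two,
      Matrix.eta_fin_two g.val, hg.apply_zero_zero, hg.apply_one_one]
    simp
  rw [nearOne_iff, hval]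
  simpa [hg.normAbs_left, hg.normAbs_right] using
    ⟨hg.normAbs_apply_zero_one, hg.normAbs_apply_one_zero⟩

lemma NearDiagonal.normAbs_inv_apply_mul_sub_one_le {r : ℝ≥0} (hr : r < 1) {a d : Fˣ}
    {g : GL (Fin 2) F} (hg : NearDiagonal r a d g) :
    normAbs ((g⁻¹).val 0 0 * a - 1) ≤ r ∧ normAbs ((g⁻¹).val 1 1 * d - 1) ≤ r := by
  obtain ⟨k, hk, hgk⟩ := hg.exists_eq_scalar_mul_diagOne_mul
  obtain ⟨h00, -, -, h11⟩ := nearOne_iff.1 (hk.inv hr)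
  have hinv : (g⁻¹).val * !![(a : F), 0; 0, (d : F)] = (k⁻¹).val := by
    rw [← scalar_mul_diagOne_div_val, ← Units.val_mul, hgk, mul_inv_rev, inv_mul_cancel_right]
  rw [← hinv] at h00 h11
  simpa [Matrix.mul_apply, Fin.sum_univ_two] using And.intro h00 h11

lemma exists_nearDiagonal {r : ℝ≥0} (hr : r < 1) {u : F} {k : maxCompact F} {g : GL (Fin 2) F}
    (hg : g = upperRightHom u * inclK k) (h10 : normAbs (g.val 1 0) ≤ r * normAbs (g.val 1 1))
    (h01 : normAbs (g.val 0 1) ≤ r * normAbs (g.val 0 0)) : ∃ a d, NearDiagonal r a d g := by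
  have hr1 : (r : ℝ) < 1 := NNReal.coe_lt_one.2 hr
  have hd : normAbs (g.val 1 1) = 1 := by
    simp only [hg, upperRightHom_mul_apply_one] at h10 ⊢
    exact normAbs_inclK_one_one (h10.trans (mul_le_of_le_one_left (normAbs_nonneg _) hr1.le))
  rw [hd, mul_one] at h10
  have hdet : normAbs (g.val 0 0 * g.val 1 1 - g.val 0 1 * g.val 1 0) = 1 := by
    rw [← Matrix.det_fin_two, hg, Units.val_mul, Matrix.det_mul, upperRightHom_val]
    simpa [Matrix.det_fin_two] using normAbs_det_inclK k
  have hoff : normAbs (g.val 0 1 * g.val 1 0) ≤ r * normAbs (g.val 0 0) := by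
    simpa using normAbs_mul_le h01 (h10.trans hr1.le)
  have ha0 : 1 ≤ normAbs (g.val 0 0) := by
    rw [← hdet]
    refine normAbs_sub_le (by rw [normAbs_mul, hd, mul_one]) (hoff.trans ?_)
    exact mul_le_of_le_one_left (normAbs_nonneg _) hr1.le
  have ha : normAbs (g.val 0 0) = 1 := by
    have hlt : normAbs (g.val 0 0 * g.val 1 1 - g.val 0 1 * g.val 1 0 - g.val 0 0 * g.val 1 1) <
        normAbs (g.val 0 0 * g.val 1 1) := by
      rw [sub_sub_cancel_left, normAbs_neg, normAbs_mul (g.val 0 0), hd, mul_one]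
      exact hoff.trans_lt (mul_lt_of_lt_one_left (one_pos.trans_le ha0) hr1)
    rw [← hdet, normAbs_eq_of_sub_lt hlt, normAbs_mul, hd, mul_one]
  have hne : ∀ {x : F}, normAbs x = 1 → x ≠ 0 := by rintro x hx rfl; simp at hx
  exact ⟨Units.mk0 _ (hne ha), Units.mk0 _ (hne hd), rfl, rfl, ha, hd, by simpa [ha] using h01, h10⟩

lemma NearDiagonal.normAbs_le_one {r : ℝ≥0} (hr : r < 1) {a d : Fˣ} {u : F} {k : maxCompact F}
    (h : NearDiagonal r a d (upperRightHom u * inclK k)) : normAbs u ≤ 1 := by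
  have hd : normAbs ((inclK k).val 1 1) = 1 := by
    rw [← upperRightHom_mul_apply_one u, h.apply_one_one, h.normAbs_right]
  have hu : u * (inclK k).val 1 1 = (upperRightHom u * inclK k).val 0 1 - (inclK k).val 0 1 := by
    rw [upperRightHom_mul_apply_zero, add_sub_cancel_left]
  calc normAbs u = normAbs (u * (inclK k).val 1 1) := by rw [normAbs_mul, hd, mul_one]
    _ ≤ 1 := by
      rw [hu]
      exact normAbs_sub_le (h.normAbs_apply_zero_one.trans (NNReal.coe_le_one.2 hr.le))
        (normAbs_inclK_le_one k 0 1)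

/-- The box of radius `r` around the base point. -/
def nearBase (r : ℝ≥0) : Set (Matrix (Fin 2) (Fin 2) F × Matrix (Fin 2) (Fin 2) F) :=
  matrixBall (basePoint F).1 r ×ˢ matrixBall (basePoint F).2 r

lemma mem_nearBase {r : ℝ≥0} {M : Matrix (Fin 2) (Fin 2) F × Matrix (Fin 2) (Fin 2) F} :
    M ∈ nearBase r ↔
      (normAbs (M.1 0 0 - 1) ≤ r ∧ normAbs (M.1 0 1) ≤ r ∧ normAbs (M.1 1 0) ≤ r ∧
        normAbs (M.1 1 1) ≤ r) ∧
      (normAbs (M.2 0 0) ≤ r ∧ normAbs (M.2 0 1) ≤ r ∧ normAbs (M.2 1 0) ≤ r ∧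
        normAbs (M.2 1 1 - 1) ≤ r) := by
  simp [nearBase, basePoint, matrixBall, Fin.forall_fin_two, and_assoc]

lemma isCompact_nearBase {r : ℝ≥0} (hr : 0 < r) : IsCompact (nearBase (F := F) r) :=
  (isCompact_matrixBall _ hr).prod (isCompact_matrixBall _ hr)

lemma isClopen_nearBase {r : ℝ≥0} (hr : 0 < r) : IsClopen (nearBase (F := F) r) :=
  ⟨(isCompact_nearBase hr).isClosed, (isOpen_matrixBall _ hr).prod (isOpen_matrixBall _ hr)⟩

lemma eventually_nearBase_subset {U : Set (Matrix (Fin 2) (Fin 2) F × Matrix (Fin 2) (Fin 2) F)}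
    (hU : U ∈ 𝓝 (basePoint F)) : ∀ᶠ r in 𝓝[>] (0 : ℝ≥0), nearBase r ⊆ U := by
  obtain ⟨s, hs, t, ht, hst⟩ := mem_nhds_prod_iff.1 hU
  filter_upwards [eventually_matrixBall_subset hs, eventually_matrixBall_subset ht] with r h₁ h₂
  exact (Set.prod_mono h₁ h₂).trans hst

lemma isSchwartzBruhat_indicator_nearBase {r : ℝ≥0} (hr : 0 < r) (c : ℂ) :
    IsSchwartzBruhat ((nearBase (F := F) r).indicator fun _ ↦ c) :=
  ⟨((LocallyConstant.const _ c).indicator (isClopen_nearBase hr)).isLocallyConstant,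
    HasCompactSupport.intro (isCompact_nearBase hr) fun _ hM ↦ Set.indicator_of_notMem hM _⟩

lemma tsupport_indicator_nearBase_subset {r : ℝ≥0} (hr : 0 < r) (c : ℂ) :
    tsupport ((nearBase (F := F) r).indicator fun _ ↦ c) ⊆ nearBase r :=
  closure_minimal Set.support_indicator_subset (isClopen_nearBase hr).isClosed

lemma normAbs_inv_apply_one_zero_le_iff {r : ℝ≥0} {g : GL (Fin 2) F} :
    normAbs ((g⁻¹).val 1 0) ≤ r * normAbs ((g⁻¹).val 0 0) ↔
      normAbs (g.val 1 0) ≤ r * normAbs (g.val 1 1) := by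
  have hdet : 0 < normAbs g.val.det⁻¹ := normAbs_pos (inv_ne_zero g.det_ne_zero)
  simp only [inv_val_fin_two, Matrix.smul_apply, Matrix.of_apply, Matrix.cons_val', smul_eq_mul,
    Matrix.cons_val_fin_one, Matrix.cons_val_zero, Matrix.cons_val_one, normAbs_mul, normAbs_neg]
  rw [mul_left_comm, mul_le_mul_iff_right₀ hdet]

lemma normAbs_inv_apply_zero_one_le_iff {r : ℝ≥0} {g : GL (Fin 2) F} :
    normAbs ((g⁻¹).val 0 1) ≤ r * normAbs ((g⁻¹).val 1 1) ↔
      normAbs (g.val 0 1) ≤ r * normAbs (g.val 0 0) := by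
  have hdet : 0 < normAbs g.val.det⁻¹ := normAbs_pos (inv_ne_zero g.det_ne_zero)
  simp only [inv_val_fin_two, Matrix.smul_apply, Matrix.of_apply, Matrix.cons_val', smul_eq_mul,
    Matrix.cons_val_fin_one, Matrix.cons_val_zero, Matrix.cons_val_one, normAbs_mul, normAbs_neg]
  rw [mul_left_comm, mul_le_mul_iff_right₀ hdet]

lemma exists_nearDiagonal_of_orbitPoint_mem {r : ℝ≥0} (hr : r < 1) {u v : F} {e : Fˣ}
    {k₁ k₂ : maxCompact F} (h : orbitPoint u v e k₁ k₂ ∈ nearBase r) :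
    (∃ a d, NearDiagonal r a d (upperRightHom u * inclK k₁)) ∧
      ∃ a d, NearDiagonal r a d (upperRightHom v * inclK k₂) := by
  simp only [mem_nearBase, orbitPoint_fst_apply, orbitPoint_snd_apply] at h
  obtain ⟨⟨h₁00, h₁01, h₁10, -⟩, -, h₂01, h₂10, h₂11⟩ := h
  have hright : ∀ z w x y : F, normAbs (z * (x * y) - 1) ≤ r → normAbs (z * (x * w)) ≤ r →
      normAbs w ≤ r * normAbs y := fun z w x y hy hw ↦ by
    rw [← mul_assoc, mul_comm] at hy hw
    exact normAbs_le_of_mul_le_of_mul_sub_one_le hr hy hw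
  have hleft : ∀ z w x y : F, normAbs (z * (x * y) - 1) ≤ r → normAbs (z * (w * y)) ≤ r →
      normAbs w ≤ r * normAbs x := fun z w x y hx hw ↦ by
    rw [mul_left_comm] at hx hw
    exact normAbs_le_of_mul_le_of_mul_sub_one_le hr hx hw
  refine ⟨exists_nearDiagonal hr rfl ?_ ?_, exists_nearDiagonal hr rfl ?_ ?_⟩
  · exact normAbs_inv_apply_one_zero_le_iff.1 (hleft _ _ _ _ h₁00 h₁10)
  · exact normAbs_inv_apply_zero_one_le_iff.1 (hleft _ _ _ _ h₂11 h₂01)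
  · exact hright _ _ _ _ h₂11 h₂10
  · exact hright _ _ _ _ h₁00 h₁01

lemma diagonal_relations_of_orbitPoint_mem {r : ℝ≥0} (hr : r < 1) {u v : F}
    {e : Fˣ} {k₁ k₂ : maxCompact F} (h : orbitPoint u v e k₁ k₂ ∈ nearBase r) {a₁ d₁ a₂ d₂ : Fˣ}
    (h₁ : NearDiagonal r a₁ d₁ (upperRightHom u * inclK k₁))
    (h₂ : NearDiagonal r a₂ d₂ (upperRightHom v * inclK k₂)) :
    normAbs (((a₂ / (e * a₁) : Fˣ) : F) - 1) ≤ r ∧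
      normAbs (((e * d₂ / d₁ : Fˣ) : F) - 1) ≤ r := by
  simp only [mem_nearBase, orbitPoint_fst_apply, orbitPoint_snd_apply, h₂.apply_zero_zero,
    h₂.apply_one_one] at h
  obtain ⟨⟨h00, -⟩, -, -, -, h11⟩ := h
  obtain ⟨hinv00, hinv11⟩ := h₁.normAbs_inv_apply_mul_sub_one_le hr
  have hne : ∀ {x y : F}, normAbs (x * y - 1) ≤ r → x ≠ 0 := fun hxy ↦ by
    rintro rfl
    simpa using normAbs_eq_one_of_sub_one_le hr hxy
  have ha := normAbs_div_sub_one_le hr h00 hinv00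
  have hd := normAbs_div_sub_one_le hr h11 hinv11
  rw [mul_left_comm, mul_div_mul_left _ _ (hne hinv00)] at ha
  rw [mul_left_comm, mul_div_mul_left _ _ (hne hinv11)] at hd
  refine ⟨?_, by simpa using hd⟩
  rw [Units.val_div_eq_div_val, Units.val_mul, ← div_div, div_eq_inv_mul _ (e : F)]
  exact ha

lemma normAbs_eq_one_of_orbitPoint_mem {r : ℝ≥0} (hr : r < 1) {u v : F}
    {e : Fˣ} {k₁ k₂ : maxCompact F} (h : orbitPoint u v e k₁ k₂ ∈ nearBase r) :
    normAbs (e : F) = 1 := by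
  obtain ⟨⟨a₁, d₁, h₁⟩, a₂, d₂, h₂⟩ := exists_nearDiagonal_of_orbitPoint_mem hr h
  simpa [h₁.normAbs_right, h₂.normAbs_right, div_eq_mul_inv] using
    normAbs_eq_one_of_sub_one_le hr (diagonal_relations_of_orbitPoint_mem hr h h₁ h₂).2

end Orbit

section CentralCharacter

variable {F : Type*} [Field F] [TopologicalSpace F] {V : Type*} [AddCommGroup V] [Module ℂ V]
  {π : Representation ℂ (GL (Fin 2) F) V} {ω : Fˣ →* ℂˣ}

lemma IsCentralCharacter.continuous [IsTopologicalRing F] (hω : IsCentralCharacter π ω)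
    (hπ : IsSmooth π) {v : V} (hv : v ≠ 0) : Continuous ω := by
  obtain ⟨U, hU⟩ := hπ v
  have hscalar : Continuous (Matrix.GeneralLinearGroup.scalar (R := F) (Fin 2)) :=
    Continuous.units_map _ (continuous_pi fun _ ↦ continuous_id).matrix_diagonal
  have hnear : ∀ᶠ z in 𝓝 (1 : Fˣ), Matrix.GeneralLinearGroup.scalar (Fin 2) z ∈ U :=
    hscalar.continuousAt.eventually_mem (U.isOpen.mem_nhds (by simp))
  refine continuous_of_continuousAt_one ω (Filter.Tendsto.congr' ?_ tendsto_const_nhds)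
  filter_upwards [hnear] with z hz
  have hzv := (hω z v).symm.trans (hU _ hz)
  rw [map_one]
  exact (Units.ext (smul_left_injective ℂ hv (hzv.trans (one_smul ℂ v).symm))).symm

end CentralCharacter

section NearDiagonalTranslates

variable {F : Type*} [Field F] [ValuativeRel F] [TopologicalSpace F]
  [IsNonarchimedeanLocalField F] {V : Type*} [AddCommGroup V] [Module ℂ V]
  {π : Representation ℂ (GL (Fin 2) F) V} {ψ : AddChar F Circle} {l : V →ₗ[ℂ] ℂ}
  {ω : Fˣ →* ℂˣ} {r : ℝ≥0} {v : V} {a d : Fˣ}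

lemma IsFixed.whittaker_diagOne_mul_nearDiagonal (hv : IsFixed π r v)
    (hω : IsCentralCharacter π ω) {g : GL (Fin 2) F} (hg : NearDiagonal r a d g) (α : Fˣ) :
    l (π (diagOne α * g) v) = ω d * l (π (diagOne (α * (a / d))) v) := by
  obtain ⟨k, hk, rfl⟩ := hg.exists_eq_scalar_mul_diagOne_mul
  have hcenter : Matrix.GeneralLinearGroup.scalar (Fin 2) d ∈ Subgroup.center (GL (Fin 2) F) :=
    Matrix.GeneralLinearGroup.center_eq_range_scalar (n := Fin 2) (R := F) ▸ ⟨d, rfl⟩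
  have hcomm : diagOne α * (Matrix.GeneralLinearGroup.scalar (Fin 2) d * diagOne (a / d) * k) =
      Matrix.GeneralLinearGroup.scalar (Fin 2) d * (diagOne (α * (a / d)) * k) := by
    rw [diagOne_mul, mul_assoc, ← mul_assoc, Subgroup.mem_center_iff.1 hcenter]
    simp only [mul_assoc]
  rw [hcomm, map_mul, Module.End.mul_apply, hω, map_smul, smul_eq_mul, hv.apply_mul hk]

lemma IsFixed.innerIntegrand_eq (hv : IsFixed π r v) (hl : IsWhittakerFunctional π ψ l)
    (hω : IsCentralCharacter π ω) (χ : Fˣ →* ℂˣ) (s : ℂ) {u : F} {k : maxCompact F}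
    (hg : NearDiagonal r a d (upperRightHom u * inclK k)) (α : Fˣ) :
    innerIntegrand ψ (fun g ↦ l (π g v)) χ s u k α =
      ω d * (χ (a / d) : ℂ)⁻¹ * zetaIntegrand (fun g ↦ l (π g v)) χ s (α * (a / d)) := by
  have hW : l (π (diagOne α * inclK k) v) * (ψ (u * α) : ℂ) =
      ω d * l (π (diagOne (α * (a / d))) v) := by
    rw [mul_comm, mul_comm u, ← hl.apply_diagOne_mul, hv.whittaker_diagOne_mul_nearDiagonal hω hg]
  have habs : absPow (a / d) (s - 1 / 2) = 1 :=
    absPow_eq_one (by simp [div_eq_mul_inv, hg.normAbs_left, hg.normAbs_right]) _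
  rw [innerIntegrand, zetaIntegrand, hW, absPow_mul, habs, map_mul, Units.val_mul]
  field_simp

end NearDiagonalTranslates

section WeightedTranslates

variable {X G : Type*} [Group G]

/-- Where the weight `o` is supported, the functions `φ₁ x` and `φ₂ x` are multiples of right
translates of `g₁` and `g₂`, and the product of the two constants with the weight is `c`. -/
structure IsWeightedTranslate (S : Set X) (o : X → ℂ) (φ₁ φ₂ : X → G → ℂ) (g₁ g₂ : G → ℂ)
    (c : ℂ) : Prop where
  weight_eq_zero : ∀ x ∉ S, o x = 0
  exists_translate : ∀ x ∈ S, ∃ (t₁ t₂ : G) (c₁ c₂ : ℂ), (∀ a, φ₁ x a = c₁ * g₁ (a * t₁)) ∧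
    (∀ b, φ₂ x b = c₂ * g₂ (b * t₂)) ∧ o x * c₁ * c₂ = c

namespace IsWeightedTranslate

variable {S : Set X} {o : X → ℂ} {φ₁ φ₂ : X → G → ℂ} {g₁ g₂ : G → ℂ} {c : ℂ}

lemma exists_mul_mul_eq (h : IsWeightedTranslate S o φ₁ φ₂ g₁ g₂ c) {x : X} (hx : x ∈ S) :
    ∃ t₁ t₂ : G, ∀ a b, o x * φ₁ x a * φ₂ x b = c * (g₁ (a * t₁) * g₂ (b * t₂)) := by
  obtain ⟨t₁, t₂, c₁, c₂, h₁, h₂, hc⟩ := h.exists_translate x hx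
  refine ⟨t₁, t₂, fun a b ↦ ?_⟩
  rw [h₁, h₂, ← hc]
  ring

variable [MeasurableSpace G] [MeasurableMul G] {dm : Measure G} [dm.IsMulRightInvariant]

lemma integral_norm_eq [SFinite dm] (h : IsWeightedTranslate S o φ₁ φ₂ g₁ g₂ c) (x : X) :
    ∫ q : G × G, ‖o x * φ₁ x q.1 * φ₂ x q.2‖ ∂(dm.prod dm) =
      S.indicator (fun _ ↦ ‖c‖ * ((∫ a, ‖g₁ a‖ ∂dm) * ∫ b, ‖g₂ b‖ ∂dm)) x := by
  by_cases hx : x ∈ S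
  · obtain ⟨t₁, t₂, ht⟩ := h.exists_mul_mul_eq hx
    simp only [Set.indicator_of_mem hx, ht, norm_mul, integral_const_mul]
    rw [integral_prod_mul (fun a ↦ ‖g₁ (a * t₁)‖) (fun b ↦ ‖g₂ (b * t₂)‖),
      integral_mul_right_eq_self (fun a ↦ ‖g₁ a‖), integral_mul_right_eq_self (fun b ↦ ‖g₂ b‖)]
  · simp [Set.indicator_of_notMem hx, h.weight_eq_zero x hx]

variable [MeasurableSpace X] {P : Measure X}

lemma integral_eq (h : IsWeightedTranslate S o φ₁ φ₂ g₁ g₂ c) (hS : MeasurableSet S) :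
    ∫ x, o x * (∫ a, φ₁ x a ∂dm) * (∫ b, φ₂ x b ∂dm) ∂P =
      P.real S * c * ((∫ a, g₁ a ∂dm) * ∫ b, g₂ b ∂dm) := by
  have hindicator : (fun x ↦ o x * (∫ a, φ₁ x a ∂dm) * ∫ b, φ₂ x b ∂dm) =
      S.indicator fun _ ↦ c * ((∫ a, g₁ a ∂dm) * ∫ b, g₂ b ∂dm) := by
    funext x
    by_cases hx : x ∈ S
    · obtain ⟨t₁, t₂, c₁, c₂, h₁, h₂, hc⟩ := h.exists_translate x hx
      simp only [h₁, h₂, integral_const_mul, integral_mul_right_eq_self, Set.indicator_of_mem hx,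
        ← hc]
      ring
    · simp [Set.indicator_of_notMem hx, h.weight_eq_zero x hx]
  rw [hindicator, integral_indicator hS, setIntegral_const, Complex.real_smul, mul_assoc]

lemma integrable [SFinite P] [SFinite dm] (h : IsWeightedTranslate S o φ₁ φ₂ g₁ g₂ c)
    (hmeas : AEStronglyMeasurable (fun p : X × G × G ↦ o p.1 * φ₁ p.1 p.2.1 * φ₂ p.1 p.2.2)
      (P.prod (dm.prod dm)))
    (hS : MeasurableSet S) (hPS : P S ≠ ⊤) (hg₁ : Integrable g₁ dm) (hg₂ : Integrable g₂ dm) :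
    Integrable (fun p : X × G × G ↦ o p.1 * φ₁ p.1 p.2.1 * φ₂ p.1 p.2.2)
      (P.prod (dm.prod dm)) := by
  refine (integrable_prod_iff hmeas).2 ⟨Filter.Eventually.of_forall fun x ↦ ?_, ?_⟩
  · by_cases hx : x ∈ S
    · obtain ⟨t₁, t₂, ht⟩ := h.exists_mul_mul_eq hx
      simp only [ht]
      exact ((hg₁.comp_mul_right t₁).mul_prod (hg₂.comp_mul_right t₂)).const_mul c
    · simp [h.weight_eq_zero x hx]
  · simp only [h.integral_norm_eq]
    exact (integrable_indicator_iff hS).2 (integrableOn_const hPS)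

end IsWeightedTranslate

end WeightedTranslates

section NearParam

variable {F : Type*} [Field F] [ValuativeRel F] [TopologicalSpace F]
  [IsNonarchimedeanLocalField F]

variable (F) in
/-- The space of the outer variables `(u, v, ε, k₁, k₂)` of the zeta integral in two complex
variables. -/
abbrev OuterParam : Type _ := F × F × Fˣ × maxCompact F × maxCompact F

variable (F) in
/-- The set of outer variables whose orbit point is close to the base point. -/
def nearParam (r : ℝ≥0) : Set (OuterParam F) :=
  {p | orbitPoint p.1 p.2.1 p.2.2.1 p.2.2.2.1 p.2.2.2.2 ∈ nearBase r}

lemma continuous_orbitPoint : Continuous fun p : OuterParam F ↦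
    orbitPoint p.1 p.2.1 p.2.2.1 p.2.2.2.1 p.2.2.2.2 := by
  have hk₁ : Continuous fun p : OuterParam F ↦ ((inclK p.2.2.2.1)⁻¹).val :=
    Units.continuous_val.comp (continuous_inv.comp (continuous_inclK.comp (by fun_prop)))
  have hk₂ : Continuous fun p : OuterParam F ↦ (inclK p.2.2.2.2).val :=
    Units.continuous_val.comp (continuous_inclK.comp (by fun_prop))
  have he : Continuous fun p : OuterParam F ↦ (p.2.2.1 : F) :=
    Units.continuous_val.comp (by fun_prop)
  have hei : Continuous fun p : OuterParam F ↦ (p.2.2.1 : F)⁻¹ := he.inv₀ fun p ↦ p.2.2.1.ne_zero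
  have hfst : Continuous fun p : OuterParam F ↦
      (!![(p.2.2.1 : F)⁻¹, (p.2.2.1 : F)⁻¹ * p.2.1; 0, 0] : Matrix (Fin 2) (Fin 2) F) :=
    continuous_matrix fun i j ↦ by fin_cases i <;> fin_cases j <;>
      simp only [Fin.zero_eta, Fin.mk_one, Fin.isValue, Matrix.of_apply, Matrix.cons_val',
        Matrix.cons_val_zero, Matrix.cons_val_one, Matrix.cons_val_fin_one] <;> fun_prop
  have hsnd : Continuous fun p : OuterParam F ↦
      (!![0, -(p.1 * p.2.2.1); 0, (p.2.2.1 : F)] : Matrix (Fin 2) (Fin 2) F) :=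
    continuous_matrix fun i j ↦ by fin_cases i <;> fin_cases j <;>
      simp only [Fin.zero_eta, Fin.mk_one, Fin.isValue, Matrix.of_apply, Matrix.cons_val',
        Matrix.cons_val_zero, Matrix.cons_val_one, Matrix.cons_val_fin_one] <;> fun_prop
  exact ((hk₁.matrix_mul hfst).matrix_mul hk₂).prodMk ((hk₁.matrix_mul hsnd).matrix_mul hk₂)

lemma isOpen_nearParam {r : ℝ≥0} (hr : 0 < r) : IsOpen (nearParam F r) :=
  (isClopen_nearBase hr).isOpen.preimage continuous_orbitPoint

lemma one_mem_nearParam (r : ℝ≥0) : ((0, 0, 1, 1, 1) : OuterParam F) ∈ nearParam F r := by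
  simp [nearParam, nearBase, matrixBall, orbitPoint, basePoint]

lemma nearParam_subset {r : ℝ≥0} (hr : r < 1) : nearParam F r ⊆
    (ball F 1 : Set F) ×ˢ (ball F 1 : Set F) ×ˢ annulus F 1 1 ×ˢ Set.univ ×ˢ Set.univ := by
  intro p hp
  obtain ⟨⟨a₁, d₁, h₁⟩, a₂, d₂, h₂⟩ := exists_nearDiagonal_of_orbitPoint_mem hr hp
  have he := normAbs_eq_one_of_orbitPoint_mem hr hp
  exact ⟨h₁.normAbs_le_one hr, h₂.normAbs_le_one hr, ⟨he.ge, he.le⟩, Set.mem_univ _,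
    Set.mem_univ _⟩

variable [MeasurableSpace F] (dx : Measure F) [dx.IsAddHaarMeasure]
  (dm : Measure Fˣ) [dm.IsHaarMeasure] (dk : Measure (maxCompact F)) [dk.IsHaarMeasure]

/-- The product measure on the space of outer variables. -/
abbrev outerMeasure : Measure (OuterParam F) :=
  dx.prod (dx.prod (dm.prod (dk.prod dk)))

lemma outerMeasure_nearParam_lt_top {r : ℝ≥0} (hr : r < 1) :
    outerMeasure dx dm dk (nearParam F r) < ⊤ :=
  (measure_mono (nearParam_subset hr)).trans_lt (IsCompact.measure_lt_top
    ((isCompact_ball one_pos).prod ((isCompact_ball one_pos).prod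
      ((isCompact_annulus one_pos).prod (isCompact_univ.prod isCompact_univ)))))

lemma outerMeasure_real_nearParam_pos {r : ℝ≥0} (hr0 : 0 < r) (hr : r < 1) :
    0 < (outerMeasure dx dm dk).real (nearParam F r) := by
  have : (dk.prod dk).IsOpenPosMeasure := inferInstance
  have : (dm.prod (dk.prod dk)).IsOpenPosMeasure := inferInstance
  have : (dx.prod (dm.prod (dk.prod dk))).IsOpenPosMeasure := inferInstance
  refine ENNReal.toReal_pos ?_ (outerMeasure_nearParam_lt_top dx dm dk hr).ne
  exact ((isOpen_nearParam hr0).measure_pos _ ⟨_, one_mem_nearParam r⟩).ne'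

end NearParam

section Bump

lemma mul_eq_one_of_diagonal_relations {A B : Type*} [CommGroup A] [CommGroup B]
    {ω₁ ω₂ μ : A →* B} (hω : ω₁ * ω₂ = 1) {e a₁ d₁ a₂ d₂ : A} (hωd : ω₂ (e * d₂ / d₁) = 1)
    (hμa : μ (a₂ / (e * a₁)) = 1) (hμd : μ (e * d₂ / d₁) = 1) :
    ω₂ e * (μ e)⁻¹ ^ 2 * (ω₁ d₁ * (μ (a₁ / d₁))⁻¹) * (ω₂ d₂ * (μ⁻¹ (a₂ / d₂))⁻¹) = 1 := by
  rw [eq_inv_of_mul_eq_one_left hω]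
  calc _ = ω₂ (e * d₂ / d₁) * μ (a₂ / (e * a₁)) * (μ (e * d₂ / d₁))⁻¹ := by
        simp only [MonoidHom.inv_apply, map_inv, map_mul, inv_inv, div_eq_mul_inv, mul_inv, pow_two,
          mul_assoc, mul_comm, mul_left_comm]
    _ = 1 := by rw [hωd, hμa, hμd, one_mul, inv_one, one_mul]

variable {F : Type*} [Field F] [ValuativeRel F] [TopologicalSpace F]
  [IsNonarchimedeanLocalField F] {V₁ V₂ : Type*} [AddCommGroup V₁] [Module ℂ V₁]
  [AddCommGroup V₂] [Module ℂ V₂] {π₁ : Representation ℂ (GL (Fin 2) F) V₁}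
  {π₂ : Representation ℂ (GL (Fin 2) F) V₂} {ψ : AddChar F Circle} {l₁ : V₁ →ₗ[ℂ] ℂ}
  {l₂ : V₂ →ₗ[ℂ] ℂ} {v₁ : V₁} {v₂ : V₂} {ω₁ ω₂ μ : Fˣ →* ℂˣ} {r : ℝ≥0}

lemma isWeightedTranslate_indicator_nearBase (hr : r < 1) (hl₁ : IsWhittakerFunctional π₁ ψ l₁)
    (hl₂ : IsWhittakerFunctional π₂ ψ l₂) (hω₁ : IsCentralCharacter π₁ ω₁)
    (hω₂ : IsCentralCharacter π₂ ω₂) (hω : ω₁ * ω₂ = 1) (hv₁ : IsFixed π₁ r v₁)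
    (hv₂ : IsFixed π₂ r v₂) (hω₂r : IsTrivialNearOne ω₂ r) (hμr : IsTrivialNearOne μ r) (c : ℂ)
    (s₁ s₂ : ℂ) :
    IsWeightedTranslate (nearParam F r)
      (fun p ↦ outerFactor ((nearBase r).indicator fun _ ↦ c) ω₂ μ s₂
        p.1 p.2.1 p.2.2.1 p.2.2.2.1 p.2.2.2.2)
      (fun p ↦ innerIntegrand ψ (fun g ↦ l₁ (π₁ g v₁)) μ s₁ p.1 p.2.2.2.1)
      (fun p ↦ innerIntegrand ψ (fun g ↦ l₂ (π₂ g v₂)) μ⁻¹ s₂ p.2.1 p.2.2.2.2)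
      (zetaIntegrand (fun g ↦ l₁ (π₁ g v₁)) μ s₁)
      (zetaIntegrand (fun g ↦ l₂ (π₂ g v₂)) μ⁻¹ s₂) c where
  weight_eq_zero p hp := by
    have hp' : orbitPoint p.1 p.2.1 p.2.2.1 p.2.2.2.1 p.2.2.2.2 ∉ nearBase r := hp
    simp [outerFactor, hp']
  exists_translate p hp := by
    obtain ⟨⟨a₁, d₁, h₁⟩, a₂, d₂, h₂⟩ := exists_nearDiagonal_of_orbitPoint_mem hr hp
    obtain ⟨ha, hd⟩ := diagonal_relations_of_orbitPoint_mem hr hp h₁ h₂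
    have hcancel := congrArg Units.val
      (mul_eq_one_of_diagonal_relations hω (hω₂r _ hd) (hμr _ ha) (hμr _ hd))
    simp only [Units.val_mul, Units.val_inv_eq_inv_val, Units.val_one] at hcancel
    refine ⟨a₁ / d₁, a₂ / d₂, _, _, hv₁.innerIntegrand_eq hl₁ hω₁ μ s₁ h₁,
      hv₂.innerIntegrand_eq hl₂ hω₂ μ⁻¹ s₂ h₂, ?_⟩
    rw [outerFactor, absPow_eq_one (normAbs_eq_one_of_orbitPoint_mem hr hp), mul_one,
      Set.indicator_of_mem (show _ ∈ nearBase r from hp), mul_assoc c, mul_assoc c, mul_assoc c,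
      hcancel, mul_one]

lemma continuous_outerFactor
    {f : Matrix (Fin 2) (Fin 2) F × Matrix (Fin 2) (Fin 2) F → ℂ} (hf : Continuous f)
    {ω : Fˣ →* ℂˣ} (hω : Continuous ω) (hμ : Continuous μ) (s : ℂ) :
    Continuous fun p : OuterParam F ↦
      outerFactor f ω μ s p.1 p.2.1 p.2.2.1 p.2.2.2.1 p.2.2.2.2 := by
  have he : Continuous fun p : OuterParam F ↦ p.2.2.1 := by fun_prop
  exact (((hf.comp continuous_orbitPoint).mul (Units.continuous_val.comp (hω.comp he))).mul
    (Units.continuous_val.comp ((hμ.comp he).inv.pow 2))).mul ((continuous_absPow _).comp he)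

lemma IsSmooth.continuous_innerIntegrand (hπ₁ : IsSmooth π₁) (hψ : Continuous ψ) (l₁ : V₁ →ₗ[ℂ] ℂ)
    (v₁ : V₁) {χ : Fˣ →* ℂˣ} (hχ : Continuous χ) (s : ℂ) :
    Continuous fun p : F × maxCompact F × Fˣ ↦
      innerIntegrand ψ (fun g ↦ l₁ (π₁ g v₁)) χ s p.1 p.2.1 p.2.2 := by
  have ha : Continuous fun p : F × maxCompact F × Fˣ ↦ p.2.2 := by fun_prop
  have hk : Continuous fun p : F × maxCompact F × Fˣ ↦ inclK p.2.1 :=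
    continuous_inclK.comp (by fun_prop)
  have hW := (hπ₁.continuous_whittaker l₁ v₁).comp ((continuous_diagOne.comp ha).mul hk)
  have hψ' := continuous_subtype_val.comp
    (hψ.comp (continuous_fst.mul (Units.continuous_val.comp ha)))
  exact ((hW.mul hψ').mul (Units.continuous_val.comp (hχ.comp ha))).mul
    ((continuous_absPow _).comp ha)

variable [MeasurableSpace F] (dx : Measure F) [dx.IsAddHaarMeasure]
  (dm : Measure Fˣ) [dm.IsHaarMeasure] (dk : Measure (maxCompact F)) [dk.IsHaarMeasure]
  [BorelSpace F]

lemma zetaTwoConverges_of_isWeightedTranslate (hπ₁ : IsSmooth π₁) (hπ₂ : IsSmooth π₂)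
    (hψ : Continuous ψ) (hω₂ : Continuous ω₂) (hμ : Continuous μ) (hr0 : 0 < r) (hr : r < 1)
    {c s₁ s₂ : ℂ} {f : Matrix (Fin 2) (Fin 2) F × Matrix (Fin 2) (Fin 2) F → ℂ}
    (hf : Continuous f)
    (h : IsWeightedTranslate (nearParam F r)
      (fun p ↦ outerFactor f ω₂ μ s₂ p.1 p.2.1 p.2.2.1 p.2.2.2.1 p.2.2.2.2)
      (fun p ↦ innerIntegrand ψ (fun g ↦ l₁ (π₁ g v₁)) μ s₁ p.1 p.2.2.2.1)
      (fun p ↦ innerIntegrand ψ (fun g ↦ l₂ (π₂ g v₂)) μ⁻¹ s₂ p.2.1 p.2.2.2.2)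
      (zetaIntegrand (fun g ↦ l₁ (π₁ g v₁)) μ s₁)
      (zetaIntegrand (fun g ↦ l₂ (π₂ g v₂)) μ⁻¹ s₂) c)
    (hz₁ : ZetaConverges dm (fun g ↦ l₁ (π₁ g v₁)) μ s₁)
    (hz₂ : ZetaConverges dm (fun g ↦ l₂ (π₂ g v₂)) μ⁻¹ s₂) :
    ZetaTwoConverges dx dm dk ψ ω₂ (fun g ↦ l₁ (π₁ g v₁)) (fun g ↦ l₂ (π₂ g v₂)) f μ s₁ s₂ := by
  have hμi : Continuous (μ⁻¹ : Fˣ →* ℂˣ) := hμ.inv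
  have hinner₁ := (hπ₁.continuous_innerIntegrand hψ l₁ v₁ hμ s₁).comp
    (f := fun p : OuterParam F × Fˣ × Fˣ ↦ (p.1.1, p.1.2.2.2.1, p.2.1)) (by fun_prop)
  have hinner₂ := (hπ₂.continuous_innerIntegrand hψ l₂ v₂ hμi s₂).comp
    (f := fun p : OuterParam F × Fˣ × Fˣ ↦ (p.1.2.1, p.1.2.2.2.2, p.2.2)) (by fun_prop)
  have houter := (continuous_outerFactor hf hω₂ hμ s₂).comp
    (continuous_fst (X := OuterParam F) (Y := Fˣ × Fˣ))
  exact h.integrable ((houter.mul hinner₁).mul hinner₂).aestronglyMeasurable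
    (isOpen_nearParam hr0).measurableSet (outerMeasure_nearParam_lt_top dx dm dk hr).ne hz₁ hz₂

theorem exists_isSchwartzBruhat_zetaTwo_eq (hπ₁ : IsSmooth π₁) (hπ₂ : IsSmooth π₂)
    (hψ : Continuous ψ) (hl₁ : IsWhittakerFunctional π₁ ψ l₁)
    (hl₂ : IsWhittakerFunctional π₂ ψ l₂) (hω₁ : IsCentralCharacter π₁ ω₁)
    (hω₂ : IsCentralCharacter π₂ ω₂) (hω : ω₁ * ω₂ = 1) (hω₂c : Continuous ω₂)
    (hμ : Continuous μ) (v₁ : V₁) (v₂ : V₂)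
    {U : Set (Matrix (Fin 2) (Fin 2) F × Matrix (Fin 2) (Fin 2) F)} (hU : U ∈ 𝓝 (basePoint F)) :
    ∃ f, IsSchwartzBruhat f ∧ tsupport f ⊆ U ∧ ∀ s₁ s₂ : ℂ,
      ZetaConverges dm (fun g ↦ l₁ (π₁ g v₁)) μ s₁ →
      ZetaConverges dm (fun g ↦ l₂ (π₂ g v₂)) μ⁻¹ s₂ →
      ZetaTwoConverges dx dm dk ψ ω₂ (fun g ↦ l₁ (π₁ g v₁)) (fun g ↦ l₂ (π₂ g v₂)) f μ s₁ s₂ ∧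
      zetaTwo dx dm dk ψ ω₂ (fun g ↦ l₁ (π₁ g v₁)) (fun g ↦ l₂ (π₂ g v₂)) f μ s₁ s₂ =
        zeta dm (fun g ↦ l₁ (π₁ g v₁)) μ s₁ * zeta dm (fun g ↦ l₂ (π₂ g v₂)) μ⁻¹ s₂ := by
  obtain ⟨r, ⟨⟨⟨⟨⟨hr, hrU⟩, hv₁⟩, hv₂⟩, hω₂r⟩, hμr⟩, hr0 : 0 < r⟩ :=
    ((((((eventually_nhdsGT_lt_one.and (eventually_nearBase_subset hU)).and
      (hπ₁.eventually_isFixed v₁)).and (hπ₂.eventually_isFixed v₂)).and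
      (eventually_isTrivialNearOne hω₂c)).and (eventually_isTrivialNearOne hμ)).and
      self_mem_nhdsWithin).exists
  have hvol := (outerMeasure_real_nearParam_pos dx dm dk (F := F) hr0 hr).ne'
  set c : ℂ := ((outerMeasure dx dm dk).real (nearParam F r) : ℂ)⁻¹ with hc
  have hSB := isSchwartzBruhat_indicator_nearBase (F := F) hr0 c
  refine ⟨(nearBase r).indicator fun _ ↦ c, hSB,
    (tsupport_indicator_nearBase_subset hr0 c).trans hrU, fun s₁ s₂ hz₁ hz₂ ↦ ?_⟩
  have htranslate := isWeightedTranslate_indicator_nearBase hr hl₁ hl₂ hω₁ hω₂ hω hv₁ hv₂ hω₂r hμr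
    c s₁ s₂
  refine ⟨zetaTwoConverges_of_isWeightedTranslate dx dm dk hπ₁ hπ₂ hψ hω₂c hμ hr0 hr
    hSB.1.continuous htranslate hz₁ hz₂, ?_⟩
  refine (htranslate.integral_eq (P := outerMeasure dx dm dk) (dm := dm)
    (isOpen_nearParam hr0).measurableSet).trans ?_
  rw [hc, mul_inv_cancel₀ (Complex.ofReal_ne_zero.2 hvol), one_mul, zeta, zeta]

end Bump

section Compact

variable {F : Type*} [Field F]

/-- The set of all `a` such that the characters `ψ(a ·)` and `ψ` agree on `L`. -/
def charAgreement (ψ : AddChar F Circle) (L : AddSubgroup F) : Set Fˣ :=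
  {a | ∀ x ∈ L, ψ (a * x) = ψ x}

lemma mem_charAgreement_iff_sub_one {ψ : AddChar F Circle} {L : AddSubgroup F} {a : Fˣ} :
    a ∈ charAgreement ψ L ↔ ∀ x ∈ L, ψ (((a : F) - 1) * x) = 1 :=
  forall₂_congr fun x _ ↦ by rw [sub_one_mul, AddChar.map_sub_eq_div, div_eq_one]

lemma isClosed_charAgreement [TopologicalSpace F] [IsTopologicalRing F] {ψ : AddChar F Circle}
    (hψ : Continuous ψ) (L : AddSubgroup F) : IsClosed (charAgreement ψ L) := by
  simp only [charAgreement, Set.ofPred_forall]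
  exact isClosed_biInter fun x _ ↦
    isClosed_eq (hψ.comp (Units.continuous_val.mul continuous_const)) continuous_const

variable [ValuativeRel F] [TopologicalSpace F] [IsNonarchimedeanLocalField F]
  {ψ : AddChar F Circle} {r : ℝ≥0}

lemma exists_charAgreement_ball_subset (hψ1 : ψ ≠ 1) (hr : 0 < r) :
    ∃ R : ℝ≥0, 0 < R ∧ ∀ a ∈ charAgreement ψ (ball F R), normAbs ((a : F) - 1) ≤ r := by
  obtain ⟨y, hy⟩ := AddChar.ne_one_iff.1 hψ1
  have hy0 : y ≠ 0 := by
    rintro rfl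
    exact hy ψ.map_zero_eq_one
  have hr' : (0 : ℝ) < r := hr
  refine ⟨⟨normAbs y, normAbs_nonneg y⟩ / r, div_pos (normAbs_pos hy0) hr, fun a ha ↦ ?_⟩
  by_contra! hlt
  have hne : (a : F) - 1 ≠ 0 := fun h0 ↦ by simp [h0, hr'.not_gt] at hlt
  refine hy ?_
  rw [← mem_charAgreement_iff_sub_one.1 ha (y / ((a : F) - 1)) ?_, mul_div_cancel₀ _ hne]
  rw [mem_ball, div_eq_mul_inv, normAbs_mul, normAbs_inv, ← div_eq_mul_inv]
  exact div_le_div_of_nonneg_left (normAbs_nonneg y) hr' hlt.le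

lemma measure_charAgreement_ball_pos [MeasurableSpace F] (dm : Measure Fˣ) [dm.IsHaarMeasure]
    (hψ : Continuous ψ) (hr : 0 < r) : 0 < dm (charAgreement ψ (ball F r)) := by
  obtain ⟨c, hc, hψc⟩ := exists_forall_addChar_mul_eq_one hψ hr
  have hopen : IsOpen {a : Fˣ | (a : F) - 1 ∈ ball F ⟨c, hc.le⟩} :=
    (isOpen_ball hc).preimage (Units.continuous_val.sub continuous_const)
  exact (hopen.measure_pos dm ⟨1, by simp⟩).trans_le
    (measure_mono fun a ha ↦ mem_charAgreement_iff_sub_one.2 (hψc _ ha))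

variable {V : Type*} [AddCommGroup V] [Module ℂ V] {π : Representation ℂ (GL (Fin 2) F) V}
  {l : V →ₗ[ℂ] ℂ} {v : V}

lemma IsFixed.whittaker_unipotentAverage (hv : IsFixed π r v) (hl : IsWhittakerFunctional π ψ l)
    (hψr : ∀ x : F, normAbs x ≤ r → ψ x = 1) (L : AddSubgroup F)
    [Fintype (L ⧸ (ball F r).addSubgroupOf L)] (a : Fˣ) :
    l (π (diagOne a) (unipotentAverage π ψ L (ball F r) v)) =
      (charAgreement ψ L).indicator (fun a ↦ l (π (diagOne a) v)) a := by
  by_cases ha : a ∈ charAgreement ψ L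
  · rw [Set.indicator_of_mem ha, hl.apply_unipotentAverage_of_eq ha]
  rw [Set.indicator_of_notMem ha]
  by_cases h0 : l (π (diagOne a) v) = 0
  · rw [hl.apply_unipotentAverage, h0, mul_zero]
  · obtain ⟨y, hy, hay⟩ : ∃ y ∈ L, ψ (a * y) ≠ ψ y := by simpa [charAgreement] using ha
    exact hl.apply_unipotentAverage_of_ne
      (fun x hx ↦ (hv.addChar_mul_eq_one hl h0 hx).trans (hψr x hx).symm) hy hay v

lemma IsFixed.zetaIntegrand_unipotentAverage (hv : IsFixed π r v)
    (hl : IsWhittakerFunctional π ψ l) (hψr : ∀ x : F, normAbs x ≤ r → ψ x = 1) (hr : r < 1)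
    {χ : Fˣ →* ℂˣ} (hχ : IsTrivialNearOne χ r) {L : AddSubgroup F}
    (hL : ∀ a ∈ charAgreement ψ L, normAbs ((a : F) - 1) ≤ r)
    [Fintype (L ⧸ (ball F r).addSubgroupOf L)] (s : ℂ) :
    zetaIntegrand (fun g ↦ l (π g (unipotentAverage π ψ L (ball F r) v))) χ s =
      (charAgreement ψ L).indicator fun _ ↦ l v := by
  funext a
  rw [zetaIntegrand, hv.whittaker_unipotentAverage hl hψr]
  by_cases ha : a ∈ charAgreement ψ L
  · rw [Set.indicator_of_mem ha, Set.indicator_of_mem ha, hv _ (nearOne_diagOne (hL a ha)),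
      hχ a (hL a ha), absPow_eq_one (normAbs_eq_one_of_sub_one_le hr (hL a ha)), Units.val_one,
      mul_one, mul_one]
  · rw [Set.indicator_of_notMem ha, Set.indicator_of_notMem ha, zero_mul, zero_mul]

lemma IsSmooth.exists_zetaIntegrand_eq_indicator [MeasurableSpace F] (dm : Measure Fˣ)
    [dm.IsHaarMeasure] (hπ : IsSmooth π) (hψ : Continuous ψ) (hψ1 : ψ ≠ 1)
    (hl : IsWhittakerFunctional π ψ l) {χ : Fˣ →* ℂˣ} (hχ : Continuous χ) (v : V) :
    ∃ (w : V) (D : Set Fˣ), IsClosed D ∧ 0 < dm D ∧ dm D < ⊤ ∧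
      ∀ s, zetaIntegrand (fun g ↦ l (π g w)) χ s = D.indicator fun _ ↦ l v := by
  obtain ⟨r, ⟨⟨⟨hr, hv⟩, hψr⟩, hχr⟩, hr0 : 0 < r⟩ :=
    ((((eventually_nhdsGT_lt_one.and (hπ.eventually_isFixed v)).and
      (eventually_addChar_eq_one hψ)).and (eventually_isTrivialNearOne hχ)).and
      self_mem_nhdsWithin).exists
  obtain ⟨R, hR, hsub⟩ := exists_charAgreement_ball_subset hψ1 hr0
  have : Finite (ball F R ⧸ (ball F r).addSubgroupOf (ball F R)) :=
    finite_quotient_addSubgroupOf (isCompact_ball hR) (isOpen_ball hr0)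
  let := Fintype.ofFinite (ball F R ⧸ (ball F r).addSubgroupOf (ball F R))
  have hannulus : charAgreement ψ (ball F R) ⊆ annulus F 1 1 := fun a ha ↦
    have ha1 := normAbs_eq_one_of_sub_one_le hr (hsub a ha)
    ⟨ha1.ge, ha1.le⟩
  exact ⟨unipotentAverage π ψ (ball F R) (ball F r) v, charAgreement ψ (ball F R),
    isClosed_charAgreement hψ _, measure_charAgreement_ball_pos dm hψ hR,
    (measure_mono hannulus).trans_lt (isCompact_annulus one_pos).measure_lt_top,
    hv.zetaIntegrand_unipotentAverage hl hψr hr hχr hsub⟩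

variable [MeasurableSpace F] [BorelSpace F] (dm : Measure Fˣ) [dm.IsHaarMeasure]

theorem IsSmooth.exists_zeta_eq_one (hπ : IsSmooth π) (hψ : Continuous ψ) (hψ1 : ψ ≠ 1)
    (hl : IsWhittakerFunctional π ψ l) (hl0 : l ≠ 0) {χ : Fˣ →* ℂˣ} (hχ : Continuous χ) :
    ∃ w : V, ∀ s : ℂ, ZetaConverges dm (fun g ↦ l (π g w)) χ s ∧
      zeta dm (fun g ↦ l (π g w)) χ s = 1 := by
  obtain ⟨v, hv⟩ := DFunLike.ne_iff.1 hl0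
  rw [LinearMap.zero_apply] at hv
  obtain ⟨w, D, hD, hD0, hDtop, hw⟩ :=
    hπ.exists_zetaIntegrand_eq_indicator dm hψ hψ1 hl hχ v
  set N : ℂ := dm.real D * l v with hN
  have hN0 : N ≠ 0 := mul_ne_zero
    (Complex.ofReal_ne_zero.2 (ENNReal.toReal_pos hD0.ne' hDtop.ne).ne') hv
  have hscaled : ∀ s, zetaIntegrand (fun g ↦ l (π g (N⁻¹ • w))) χ s =
      D.indicator fun _ ↦ N⁻¹ * l v := fun s ↦ by
    funext a
    rw [Set.indicator_const_mul, ← hw s]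
    simp only [zetaIntegrand, map_smul, smul_eq_mul, mul_assoc]
  refine ⟨N⁻¹ • w, fun s ↦ ⟨?_, ?_⟩⟩
  · rw [ZetaConverges, hscaled]
    exact (integrable_indicator_iff hD.measurableSet).2 (integrableOn_const hDtop.ne)
  · rw [zeta, hscaled, integral_indicator hD.measurableSet, setIntegral_const, Complex.real_smul,
      mul_left_comm, ← hN, inv_mul_cancel₀ hN0]

end Compact

end GLTwoZeta

end

theorem mainTheorem7_general {F : Type*} [Field F] [ValuativeRel F] [TopologicalSpace F]
    [IsNonarchimedeanLocalField F] [MeasurableSpace F] [BorelSpace F]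
    (dx : Measure F) [dx.IsAddHaarMeasure]
    (dm : Measure Fˣ) [dm.IsHaarMeasure]
    (dk : Measure (GLTwoZeta.maxCompact F)) [dk.IsHaarMeasure]
    (ψ : AddChar F Circle) (hψ : Continuous ψ) (hψ1 : ψ ≠ 1)
    {V₁ V₂ : Type*} [AddCommGroup V₁] [Module ℂ V₁] [AddCommGroup V₂] [Module ℂ V₂]
    (π₁ : Representation ℂ (GL (Fin 2) F) V₁) (π₂ : Representation ℂ (GL (Fin 2) F) V₂)
    (hπ₁ : GLTwoZeta.IsAdmissible π₁) (hπ₂ : GLTwoZeta.IsAdmissible π₂)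
    (hgen₁ : GLTwoZeta.IsGeneric π₁ ψ) (hgen₂ : GLTwoZeta.IsGeneric π₂ ψ)
    (ω₁ ω₂ : Fˣ →* ℂˣ) (hω₁ : GLTwoZeta.IsCentralCharacter π₁ ω₁)
    (hω₂ : GLTwoZeta.IsCentralCharacter π₂ ω₂) (hω : ω₁ * ω₂ = 1)
    (μ : Fˣ →* ℂˣ) (hμ : Continuous μ) :
    (∀ W₁ ∈ GLTwoZeta.whittakerModel π₁ ψ, ∀ W₂ ∈ GLTwoZeta.whittakerModel π₂ ψ,
      (∃ σ : ℝ, ∀ s : ℂ, σ < s.re →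
        GLTwoZeta.ZetaConverges dm W₁ μ s ∧ GLTwoZeta.ZetaConverges dm W₂ μ⁻¹ s) ∧
      ∀ U ∈ 𝓝 (GLTwoZeta.basePoint F),
        ∃ f : Matrix (Fin 2) (Fin 2) F × Matrix (Fin 2) (Fin 2) F → ℂ,
          GLTwoZeta.IsSchwartzBruhat f ∧ tsupport f ⊆ U ∧
          ∀ s₁ s₂ : ℂ,
            GLTwoZeta.ZetaConverges dm W₁ μ s₁ → GLTwoZeta.ZetaConverges dm W₂ μ⁻¹ s₂ →
              GLTwoZeta.ZetaTwoConverges dx dm dk ψ ω₂ W₁ W₂ f μ s₁ s₂ ∧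
              GLTwoZeta.zetaTwo dx dm dk ψ ω₂ W₁ W₂ f μ s₁ s₂ =
                GLTwoZeta.zeta dm W₁ μ s₁ * GLTwoZeta.zeta dm W₂ μ⁻¹ s₂) ∧
    (∃ W₁ ∈ GLTwoZeta.whittakerModel π₁ ψ, ∃ W₂ ∈ GLTwoZeta.whittakerModel π₂ ψ,
      ∃ f : Matrix (Fin 2) (Fin 2) F × Matrix (Fin 2) (Fin 2) F → ℂ,
        GLTwoZeta.IsSchwartzBruhat f ∧
        ∀ s₁ s₂ : ℂ,
          GLTwoZeta.ZetaTwoConverges dx dm dk ψ ω₂ W₁ W₂ f μ s₁ s₂ ∧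
          GLTwoZeta.zetaTwo dx dm dk ψ ω₂ W₁ W₂ f μ s₁ s₂ = 1) := by
  have hμi : Continuous (μ⁻¹ : Fˣ →* ℂˣ) := hμ.inv
  obtain ⟨m₁, hm₁0, hm₁⟩ := hgen₁
  obtain ⟨m₂, hm₂0, hm₂⟩ := hgen₂
  have hω₂c : Continuous ω₂ := by
    obtain ⟨x, hx⟩ := DFunLike.ne_iff.1 hm₂0
    exact hω₂.continuous hπ₂.smooth (ne_zero_of_map hx)
  constructor
  · rintro _ ⟨l₁, v₁, hl₁, rfl⟩ _ ⟨l₂, v₂, hl₂, rfl⟩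
    obtain ⟨σ₁, h₁⟩ := hπ₁.exists_zetaConverges dm hψ hψ1 hl₁ hμ v₁
    obtain ⟨σ₂, h₂⟩ := hπ₂.exists_zetaConverges dm hψ hψ1 hl₂ hμi v₂
    exact ⟨⟨max σ₁ σ₂, fun s hs ↦ ⟨h₁ s (max_lt_iff.1 hs).1, h₂ s (max_lt_iff.1 hs).2⟩⟩,
      fun U hU ↦ GLTwoZeta.exists_isSchwartzBruhat_zetaTwo_eq dx dm dk hπ₁.smooth hπ₂.smooth hψ
        hl₁ hl₂ hω₁ hω₂ hω hω₂c hμ v₁ v₂ hU⟩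
  · obtain ⟨w₁, hw₁⟩ := hπ₁.smooth.exists_zeta_eq_one dm hψ hψ1 hm₁ hm₁0 hμ
    obtain ⟨w₂, hw₂⟩ := hπ₂.smooth.exists_zeta_eq_one dm hψ hψ1 hm₂ hm₂0 hμi
    obtain ⟨f, hf, -, hfZ⟩ := GLTwoZeta.exists_isSchwartzBruhat_zetaTwo_eq dx dm dk hπ₁.smooth
      hπ₂.smooth hψ hm₁ hm₂ hω₁ hω₂ hω hω₂c hμ w₁ w₂ Filter.univ_mem
    refine ⟨_, ⟨m₁, w₁, hm₁, rfl⟩, _, ⟨m₂, w₂, hm₂, rfl⟩, f, hf, fun s₁ s₂ ↦ ?_⟩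
    obtain ⟨hconv, heq⟩ := hfZ s₁ s₂ (hw₁ s₁).1 (hw₂ s₂).1
    exact ⟨hconv, by rw [heq, (hw₁ s₁).2, (hw₂ s₂).2, mul_one]⟩

theorem mainTheorem7 {F : Type*} [Field F] [ValuativeRel F] [TopologicalSpace F]
    [IsNonarchimedeanLocalField F] [MeasurableSpace F] [BorelSpace F]
    (dx : Measure F) [dx.IsAddHaarMeasure]
    (dm : Measure Fˣ) [dm.IsHaarMeasure]
    (dk : Measure (GLTwoZeta.maxCompact F)) [dk.IsHaarMeasure]
    (ψ : AddChar F Circle) (hψ : Continuous ψ) (hψ1 : ψ ≠ 1)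
    {V₁ V₂ : Type*} [AddCommGroup V₁] [Module ℂ V₁] [AddCommGroup V₂] [Module ℂ V₂]
    (π₁ : Representation ℂ (GL (Fin 2) F) V₁) (π₂ : Representation ℂ (GL (Fin 2) F) V₂)
    (hπ₁ : GLTwoZeta.IsIrredAdmissible π₁) (hπ₂ : GLTwoZeta.IsIrredAdmissible π₂)
    (hgen₁ : GLTwoZeta.IsGeneric π₁ ψ) (hgen₂ : GLTwoZeta.IsGeneric π₂ ψ)
    (ω₁ ω₂ : Fˣ →* ℂˣ) (hω₁ : GLTwoZeta.IsCentralCharacter π₁ ω₁)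
    (hω₂ : GLTwoZeta.IsCentralCharacter π₂ ω₂) (hω : ω₁ * ω₂ = 1)
    (μ : Fˣ →* ℂˣ) (hμ : Continuous μ) :
    (∀ W₁ ∈ GLTwoZeta.whittakerModel π₁ ψ, ∀ W₂ ∈ GLTwoZeta.whittakerModel π₂ ψ,
      (∃ σ : ℝ, ∀ s : ℂ, σ < s.re →
        GLTwoZeta.ZetaConverges dm W₁ μ s ∧ GLTwoZeta.ZetaConverges dm W₂ μ⁻¹ s) ∧
      ∀ U ∈ 𝓝 (GLTwoZeta.basePoint F),
        ∃ f : Matrix (Fin 2) (Fin 2) F × Matrix (Fin 2) (Fin 2) F → ℂ,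
          GLTwoZeta.IsSchwartzBruhat f ∧ tsupport f ⊆ U ∧
          ∀ s₁ s₂ : ℂ,
            GLTwoZeta.ZetaConverges dm W₁ μ s₁ → GLTwoZeta.ZetaConverges dm W₂ μ⁻¹ s₂ →
              GLTwoZeta.ZetaTwoConverges dx dm dk ψ ω₂ W₁ W₂ f μ s₁ s₂ ∧
              GLTwoZeta.zetaTwo dx dm dk ψ ω₂ W₁ W₂ f μ s₁ s₂ =
                GLTwoZeta.zeta dm W₁ μ s₁ * GLTwoZeta.zeta dm W₂ μ⁻¹ s₂) ∧
    (∃ W₁ ∈ GLTwoZeta.whittakerModel π₁ ψ, ∃ W₂ ∈ GLTwoZeta.whittakerModel π₂ ψ,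
      ∃ f : Matrix (Fin 2) (Fin 2) F × Matrix (Fin 2) (Fin 2) F → ℂ,
        GLTwoZeta.IsSchwartzBruhat f ∧
        ∀ s₁ s₂ : ℂ,
          GLTwoZeta.ZetaTwoConverges dx dm dk ψ ω₂ W₁ W₂ f μ s₁ s₂ ∧
          GLTwoZeta.zetaTwo dx dm dk ψ ω₂ W₁ W₂ f μ s₁ s₂ = 1) := by
  exact mainTheorem7_general dx dm dk ψ hψ hψ1 π₁ π₂ hπ₁.isAdmissible hπ₂.isAdmissible hgen₁ hgen₂
    ω₁ ω₂ hω₁ hω₂ hω μ hμ
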